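/- Categories may be large (objects and morphisms form classes); a category is small if its objects and its morphisms form sets. A subcategory need not be full. A functor between small categories is a weak equivalence if its nerve is a weak equivalence of simplicial sets; two small categories are weakly equivalent if a finite zigzag of weak equivalences of small categories connects them. A core of a category $\mathcal{C}$ is a small subcategory $I\subset\mathcal{C}$ such that for every small subcategory $J\subset\mathcal{C}$ with $I\subset J$ there is a small subcategory $K\subset\mathcal{C}$ with $J\subset K$ for which the inclusion $I\subset K$ is a weak equivalence. A category is essentially small if it has a core. A functor $f\colon\mathcal{B}\to\mathcal{A}$ between arbitrary categories is a weak equivalence if there are cores $B\subset\mathcal{B}$ and $A\subset\mathcal{A}$ such that $f$ takes $B$ to $A$ and the restriction $f\colon B\to A$ is a weak equivalence of small categories. Functors $f,g\colon\mathcal{B}\to\mathcal{A}$ are homotopic if there are functors and natural transformations $f=h_0\to h_1\leftarrow\cdots\leftarrow h_n=g$. A functor $f\colon\mathcal{B}\to\mathcal{A}$ is a homotopy equivalence if there is a functor $g\colon\mathcal{A}\to\mathcal{B}$ such that $fg$ and $gf$ are homotopic to $\mathrm{id}_{\mathcal{A}}$ and $\mathrm{id}_{\mathcal{B}}$. The components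 of a category are the classes of objects connected by finite zigzags of morphisms; $\pi_0$ denotes the class of components. A category is discrete if its only morphisms are identities. Theorem. (1) If $I\subset\mathcal{C}$ and $J\subset\mathcal{C}$ are cores of a category $\mathcal{C}$, then $I$ and $J$ are weakly equivalent. (2) A discrete essentially small category is small. (3) If $\mathcal{C}$ is essentially small, then its components form a set, and for every core $I\subset\mathcal{C}$ the inclusion induces a bijection $\pi_0(I)\to\pi_0(\mathcal{C})$. (4) Let $f\colon\mathcal{B}\to\mathcal{A}$ and $r\colon\mathcal{A}\to\mathcal{B}$ be functors such that $\mathcal{A}$ is essentially small and $rf$ is homotopic to $\mathrm{id}_{\mathcal{B}}$. Then $\mathcal{B}$ is essentially small, and there are cores $A\subset\mathcal{A}$ and $B\subset\mathcal{B}$ such that $f$ takes $B$ to $A$ and $r$ takes $A$ to $B$. (5) If $f\colon\mathcal{B}\to\mathcal{A}$ is a homotopy equivalence, then $\mathcal{A}$ is essentially small if and only if $\mathcal{B}$ is. (6) If $f\colon\mathcal{B}\to\mathcal{A}$ is a homotopy equivalence and both $\mathcal{A}$ and $\mathcal{B}$ are essentially small, then $f$ is a weak equivalence. -/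

import Mathlib

open CategoryTheory

universe w v u

namespace CoreHomotopy

/-- A (not necessarily full) subcategory of `C`: a class of objects and a class of morphisms
between those objects that contains the identities and is closed under composition. -/
structure Subcat (C : Type u) [Category.{v} C] where
  obj : ObjectProperty C
  hom : MorphismProperty C
  source_mem : ∀ {x y : C} (f : x ⟶ y), hom f → obj x
  target_mem : ∀ {x y : C} (f : x ⟶ y), hom f → obj y
  id_mem : ∀ x : C, obj x → hom (𝟙 x)
  comp_mem : ∀ {x y z : C} (f : x ⟶ y) (g : y ⟶ z), hom f → hom g → hom (f ≫ g)

/-- A category is `w`-small if its objects form a `w`-small set and so do the morphisms between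
any two objects. -/
def IsSmallCategory (C : Type u) [Category.{v} C] : Prop :=
  Small.{w} C ∧ LocallySmall.{w} C

namespace Subcat

variable {C : Type u} [Category.{v} C] {D : Type u} [Category.{v} D]

/-- The objects of a subcategory, as the objects of a category of their own. -/
def Carrier (I : Subcat C) : Type u := {x : C // I.obj x}

instance (I : Subcat C) : Category.{v} I.Carrier where
  Hom x y := {f : x.1 ⟶ y.1 // I.hom f}
  id x := ⟨𝟙 x.1, I.id_mem x.1 x.2⟩
  comp f g := ⟨f.1 ≫ g.1, I.comp_mem f.1 g.1 f.2 g.2⟩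

/-- The inclusion functor of a subcategory. -/
def ι (I : Subcat C) : I.Carrier ⥤ C where
  obj x := x.1
  map f := f.1

instance : LE (Subcat C) where
  le I J := I.obj ≤ J.obj ∧ I.hom ≤ J.hom

/-- The inclusion functor between nested subcategories. -/
def inclusion {I J : Subcat C} (h : I ≤ J) : I.Carrier ⥤ J.Carrier where
  obj x := ⟨x.1, h.1 x.1 x.2⟩
  map f := ⟨f.1, h.2 f.1 f.2⟩

/-- The functor `F` takes the subcategory `I` of its source to the subcategory `J` of its
target. -/
structure MapsTo (F : C ⥤ D) (I : Subcat C) (J : Subcat D) : Prop where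
  obj : ∀ x : C, I.obj x → J.obj (F.obj x)
  hom : ∀ {x y : C} (f : x ⟶ y), I.hom f → J.hom (F.map f)

/-- The restriction of a functor to subcategories. -/
def restrict (F : C ⥤ D) {I : Subcat C} {J : Subcat D} (h : MapsTo F I J) :
    I.Carrier ⥤ J.Carrier where
  obj x := ⟨F.obj x.1, h.obj x.1 x.2⟩
  map f := ⟨F.map f.1, h.hom f.1 f.2⟩
  map_id x := Subtype.ext (F.map_id x.1)
  map_comp f g := Subtype.ext (F.map_comp f.1 g.1)

end Subcat

/-- Two maps of simplicial sets lie in the same homotopy class: they are related by the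
equivalence relation generated by simplicial homotopies `X ⊗ Δ[1] ⟶ K`. -/
def SameHomotopyClass {X K : SSet.{u}} (g g' : X ⟶ K) : Prop :=
  Relation.EqvGen (fun a b : X ⟶ K => Nonempty (SSet.Homotopy a b)) g g'

/-- Weak (homotopy) equivalences of simplicial sets: for every Kan complex `K`, precomposition
with `f` is a bijection from homotopy classes of maps `Y ⟶ K` to homotopy classes of maps
`X ⟶ K`. -/
def IsSSetWeakEquivalence {X Y : SSet.{u}} (f : X ⟶ Y) : Prop :=
  ∀ K : SSet.{u}, SSet.KanComplex K →
    (∀ g g' : Y ⟶ K, SameHomotopyClass (f ≫ g) (f ≫ g') → SameHomotopyClass g g') ∧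
    (∀ g : X ⟶ K, ∃ g' : Y ⟶ K, SameHomotopyClass (f ≫ g') g)

/-- The nerve of the functor is a weak equivalence. This is the notion of weak equivalence used
for functors between small categories. -/
def IsNerveWeakEquivalence {C D : Type u} [Category.{v} C] [Category.{v} D] (F : C ⥤ D) : Prop :=
  IsSSetWeakEquivalence (nerveMap F)

/-- Two small categories are weakly equivalent: they are connected by a finite zigzag of weak
equivalences of small categories. -/
def WeaklyEquivalent (C D : Type u) [Category.{v} C] [Category.{v} D] : Prop :=
  Relation.EqvGen
    (fun X Y : Cat.{v, u} => IsSmallCategory.{w} X ∧ IsSmallCategory.{w} Y ∧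
      ∃ F : X ⥤ Y, IsNerveWeakEquivalence F)
    (Cat.of C) (Cat.of D)

/-- A core of `C`: a small subcategory `I` such that every small subcategory `J` containing `I`
is contained in a small subcategory `K` for which the inclusion of `I` is a weak equivalence. -/
def IsCore {C : Type u} [Category.{v} C] (I : Subcat C) : Prop :=
  IsSmallCategory.{w} I.Carrier ∧
    ∀ J : Subcat C, IsSmallCategory.{w} J.Carrier → I ≤ J →
      ∃ K : Subcat C, IsSmallCategory.{w} K.Carrier ∧ J ≤ K ∧
        ∃ h : I ≤ K, IsNerveWeakEquivalence (Subcat.inclusion h)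

/-- Essentially small (also called homotopically small) categories: those that have a core.
This is weaker than `CategoryTheory.EssentiallySmall`. -/
def IsEssentiallySmall (C : Type u) [Category.{v} C] : Prop :=
  ∃ I : Subcat C, IsCore.{w} I

/-- Two functors are homotopic if a finite zigzag of natural transformations connects them. -/
def FunctorHomotopic {B A : Type u} [Category.{v} B] [Category.{v} A] (f g : B ⥤ A) : Prop :=
  Zigzag f g

/-- A functor is a homotopy equivalence if it has a homotopy inverse. -/
def IsHomotopyEquivalence {B A : Type u} [Category.{v} B] [Category.{v} A] (f : B ⥤ A) : Prop :=
  ∃ g : A ⥤ B, FunctorHomotopic (g ⋙ f) (𝟭 A) ∧ FunctorHomotopic (f ⋙ g) (𝟭 B)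

/-- Weak equivalences of arbitrary categories: functors `f : B ⥤ A` having a core, i.e. cores of
`B` and `A` with the first taken to the second by `f`, on which `f` restricts to a weak
equivalence of small categories. -/
def IsWeakEquivalence {B A : Type u} [Category.{v} B] [Category.{v} A] (f : B ⥤ A) : Prop :=
  ∃ (I : Subcat B) (J : Subcat A), IsCore.{w} I ∧ IsCore.{w} J ∧
    ∃ h : Subcat.MapsTo f I J, IsNerveWeakEquivalence (Subcat.restrict f h)

end CoreHomotopy

/-! Everything rests on two facts about nerves: natural transformations give homotopies, and a
countable increasing union of weakly equivalent inclusions is again a weak equivalence. The second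
is the hard one, since extensions known only up to homotopy cannot be glued. For a monomorphism `i :
X ⟶ Y` and a Kan complex `K`, the restriction `K^Y ⟶ K^X` is a fibration. If `i` is a weak
equivalence, it has a section that is a homotopy inverse, hence it lifts against all monomorphisms.
This turns weak equivalence into a strict extension property (`RelativeExtensionProperty`), which is
solved stage by stage along a union.

For cores, two-out-of-three lets any small set of arrows be added to a core, and two-out-of-six
makes every inclusion between cores a weak equivalence. Any two cores therefore lie in a common one,
which gives (1). A zigzag has finitely many arrows, so it lies in a larger core; testing against the
two-point Kan complex then gives (3), and (2) follows because the objects of a discrete category are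
its components.

For (4), a core of `A` and a small subcategory of `B` are enlarged alternately. Their unions are
closed under `f`, `r` and the homotopy from `rf` to the identity (`IsCore.exists_closed`). Any small
enlargement in `B` can be closed up in the same way, so its inclusion is a homotopy retract of an
inclusion of cores of `A`. Applying (4) in both directions gives (5); closing under both homotopies
makes the restrictions homotopy inverse, which is (6). -/

namespace CoreHomotopy

open Simplicial MonoidalCategory CartesianMonoidalCategory HomotopicalAlgebra Limits SSet
  SSet.modelCategoryQuillen

/-! ### Lifting homotopies along fibrations -/

/-- The two inclusions of a vertex in `Δ[1]` are anodyne extensions. -/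
lemma anodyneExtensions_vertex (j : Fin 2) :
    anodyneExtensions.{u} (stdSimplex.δ j : Δ[0] ⟶ Δ[1]) := by
  intro E B p hp
  have : Fibration p := by rwa [HomotopicalAlgebra.fibration_iff]
  obtain ⟨i, hi⟩ : ∃ i : Fin 2, j ≠ i := ⟨1 - j, by fin_cases j <;> decide⟩
  have key : ∀ k : Fin 2, k ≠ i → k = j := by
    intro k hk; fin_cases j <;> fin_cases i <;> fin_cases k <;> simp_all
  refine ⟨fun {t b} sq ↦ ?_⟩
  -- A horn in `Δ[1]` is a single vertex, so its compatibility condition is vacuous.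
  obtain ⟨φ, h₁, h₂⟩ := horn.IsCompatible.exists_lift (n := 0) (i := i) (X := E)
    (f := fun _ _ ↦ t) trivial p b (fun k hk ↦ by obtain rfl := key k hk; exact sq.w)
  exact ⟨⟨{ l := φ, fac_left := h₁ j hi, fac_right := h₂ }⟩⟩

/-- The coface `δ 1` omits vertex `1`, hence is the inclusion of vertex `0`; this is why `δ 1` goes
with `ι₀` and `δ 0` with `ι₁`. -/
lemma δ_one_eq_const : (stdSimplex.δ 1 : Δ[0] ⟶ Δ[1]) =
    SSet.const (stdSimplex.obj₀Equiv.{u}.symm 0) := by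
  apply yonedaEquiv.injective
  ext i
  fin_cases i
  rfl
lemma δ_zero_eq_const : (stdSimplex.δ 0 : Δ[0] ⟶ Δ[1]) =
    SSet.const (stdSimplex.obj₀Equiv.{u}.symm 1) := by
  apply yonedaEquiv.injective
  ext i
  fin_cases i
  rfl

lemma whiskerLeft_δ_one (X : SSet.{u}) :
    X ◁ (stdSimplex.δ 1 : Δ[0] ⟶ Δ[1]) = fst _ _ ≫ ι₀ := by
  rw [δ_one_eq_const]; rfl

lemma whiskerLeft_δ_zero (X : SSet.{u}) :
    X ◁ (stdSimplex.δ 0 : Δ[0] ⟶ Δ[1]) = fst _ _ ≫ ι₁ := by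
  rw [δ_zero_eq_const]; rfl

lemma fst_point_comp_cancel {X Y : SSet.{u}} {f g : X ⟶ Y}
    (h : fst X Δ[0] ≫ f = fst X Δ[0] ≫ g) : f = g := by
  have := lift (𝟙 X) (SSet.const (stdSimplex.obj₀Equiv.symm 0) : X ⟶ Δ[0]) ≫= h
  simpa using this

/-- A fibration lifts maps along the pushout-product of a monomorphism and an anodyne extension. -/
lemma exists_relative_lift {E B M N : SSet.{u}} (p : E ⟶ B) [Fibration p] (m : M ⟶ N) [Mono m]
    {Λ Δ : SSet.{u}} {j : Λ ⟶ Δ} (hj : anodyneExtensions j)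
    (c : N ⊗ Λ ⟶ E) (h : M ⊗ Δ ⟶ E) (k : N ⊗ Δ ⟶ B)
    (w : m ▷ Λ ≫ c = M ◁ j ≫ h) (hk : m ▷ Δ ≫ k = h ≫ p) (hc : N ◁ j ≫ k = c ≫ p) :
    ∃ l : N ⊗ Δ ⟶ E, N ◁ j ≫ l = c ∧ m ▷ Δ ≫ l = h ∧ l ≫ p = k := by
  let sq := Functor.PushoutObjObj.ofHasPushout (curriedTensor SSet.{u}) m j
  have ha := anodyneExtensions_pushoutObjObjι sq hj
  have := ha _ (by rwa [← HomotopicalAlgebra.fibration_iff] : fibrations _ p)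
  have comm : CommSq (sq.isPushout.desc c h w) sq.ι p k := ⟨by
    apply sq.isPushout.hom_ext
    · rw [IsPushout.inl_desc_assoc, sq.inl_ι_assoc]; exact hc.symm
    · rw [IsPushout.inr_desc_assoc, sq.inr_ι_assoc]; exact hk.symm⟩
  refine ⟨comm.lift, ?_, ?_, comm.fac_right⟩
  · have := sq.inl ≫= comm.fac_left
    rw [IsPushout.inl_desc, sq.inl_ι_assoc] at this
    exact this
  · have := sq.inr ≫= comm.fac_left
    rw [IsPushout.inr_desc, sq.inr_ι_assoc] at this
    exact this

/-- Relative homotopy lifting, starting from the end `0`. -/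
lemma exists_homotopy_lift₀ {E B M N : SSet.{u}} (p : E ⟶ B) [Fibration p] (m : M ⟶ N) [Mono m]
    (c : N ⟶ E) (h : M ⊗ Δ[1] ⟶ E) (k : N ⊗ Δ[1] ⟶ B)
    (h₀ : ι₀ ≫ h = m ≫ c) (hk : m ▷ _ ≫ k = h ≫ p) (k₀ : ι₀ ≫ k = c ≫ p) :
    ∃ l : N ⊗ Δ[1] ⟶ E, ι₀ ≫ l = c ∧ m ▷ _ ≫ l = h ∧ l ≫ p = k := by
  obtain ⟨l, h1, h2, h3⟩ := exists_relative_lift p m (anodyneExtensions_vertex 1) (fst _ _ ≫ c) h k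
    (by rw [whiskerLeft_δ_one, Category.assoc, h₀, whiskerRight_fst_assoc]) hk
    (by rw [whiskerLeft_δ_one, Category.assoc, k₀, Category.assoc])
  rw [whiskerLeft_δ_one, Category.assoc] at h1
  exact ⟨l, fst_point_comp_cancel h1, h2, h3⟩

/-- Lifting of a `2`-simplex of homotopies from its horn at the vertex `0`. -/
lemma exists_triangle_lift {E B X : SSet.{u}} (p : E ⟶ B) [Fibration p]
    (e₀₁ e₀₂ : X ⊗ Δ[1] ⟶ E) (b : X ⊗ Δ[2] ⟶ B) (h₀ : ι₀ ≫ e₀₁ = ι₀ ≫ e₀₂)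
    (h₁ : e₀₁ ≫ p = X ◁ stdSimplex.δ 2 ≫ b) (h₂ : e₀₂ ≫ p = X ◁ stdSimplex.δ 1 ≫ b) :
    ∃ t : X ⊗ Δ[2] ⟶ E, X ◁ stdSimplex.δ 2 ≫ t = e₀₁ ∧ X ◁ stdSimplex.δ 1 ≫ t = e₀₂ ∧
      t ≫ p = b := by
  -- By adjunction this is a horn at vertex `0` in the internal hom from `X` to `E`, with faces `1`
  -- and `2` agreeing at that vertex.
  have : horn.IsCompatible (n := 1) (i := 0) (X := (ihom X).obj E)
      (fun j _ ↦ if j = 1 then MonoidalClosed.curry e₀₂ else MonoidalClosed.curry e₀₁) := by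
    intro j k hj hk hjk
    obtain rfl : j = 1 := by grind
    obtain rfl : k = 2 := by grind
    simp [← MonoidalClosed.curry_natural_left]
    congr 1
    change X ◁ stdSimplex.δ 1 ≫ _ = X ◁ stdSimplex.δ 1 ≫ _
    rw [whiskerLeft_δ_one, Category.assoc, Category.assoc, h₀]
  obtain ⟨φ, h₃, h₄⟩ := this.exists_lift ((ihom X).map p) (MonoidalClosed.curry b) (by
    intro j hj
    split_ifs with h
    · subst h
      rw [← MonoidalClosed.curry_natural_left, ← MonoidalClosed.curry_natural_right, h₂]
    · obtain rfl : j = 2 := by grind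
      rw [← MonoidalClosed.curry_natural_left, ← MonoidalClosed.curry_natural_right, h₁])
  refine ⟨MonoidalClosed.uncurry φ, ?_, ?_, ?_⟩
  · rw [← MonoidalClosed.uncurry_natural_left, h₃ 2 (by simp)]
    simp
  · rw [← MonoidalClosed.uncurry_natural_left, h₃ 1 (by simp)]
    simp
  · rw [← MonoidalClosed.uncurry_natural_right, h₄]
    simp

/-! ### Homotopy classes of maps to Kan complexes -/

/-- The remaining field of a homotopy is a condition on the empty subcomplex. -/
lemma nonempty_homotopy_iff {X K : SSet.{u}} (f g : X ⟶ K) :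
    Nonempty (SSet.Homotopy f g) ↔ ∃ h : X ⊗ Δ[1] ⟶ K, ι₀ ≫ h = f ∧ ι₁ ≫ h = g := by
  refine ⟨fun ⟨H⟩ ↦ ⟨H.h, H.h₀, H.h₁⟩, fun ⟨h, h₀, h₁⟩ ↦ ⟨⟨h, h₀, h₁, ?_⟩⟩⟩
  ext n ⟨⟨x, hx⟩, y⟩
  exact hx.elim

lemma ι₀_whiskerLeft (X : SSet.{u}) {Y : SSet.{u}} (g : Δ[1] ⟶ Y) :
    ι₀ ≫ X ◁ g = lift (𝟙 X) (SSet.const (g.app _ (stdSimplex.obj₀Equiv.symm 0))) := by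
  rw [ι₀, CartesianMonoidalCategory.lift_whiskerLeft, SSet.const_comp]

lemma ι₁_whiskerLeft (X : SSet.{u}) {Y : SSet.{u}} (g : Δ[1] ⟶ Y) :
    ι₁ ≫ X ◁ g = lift (𝟙 X) (SSet.const (g.app _ (stdSimplex.obj₀Equiv.symm 1))) := by
  rw [ι₁, CartesianMonoidalCategory.lift_whiskerLeft, SSet.const_comp]

lemma ι₁_whiskerLeft_δ_two (X : SSet.{u}) :
    ι₁ ≫ X ◁ (stdSimplex.δ 2 : Δ[1] ⟶ Δ[2]) = ι₀ ≫ X ◁ stdSimplex.δ 0 := by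
  rw [ι₁_whiskerLeft, ι₀_whiskerLeft]
  congr 2

lemma ι₁_whiskerLeft_δ_one (X : SSet.{u}) :
    ι₁ ≫ X ◁ (stdSimplex.δ 1 : Δ[1] ⟶ Δ[2]) = ι₁ ≫ X ◁ stdSimplex.δ 0 := by
  rw [ι₁_whiskerLeft, ι₁_whiskerLeft]
  congr 2

instance {K : SSet.{u}} [KanComplex K] : Fibration (terminal.from K) :=
  (isFibrant_iff K).1 inferInstance

/-- If `f₀` is homotopic to both `f₁` and `f₂`, then `f₁` is homotopic to `f₂`. -/
lemma nonempty_homotopy_of_kanComplex {X K : SSet.{u}} [KanComplex K] {f₀ f₁ f₂ : X ⟶ K}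
    (h₁ : Nonempty (SSet.Homotopy f₀ f₁)) (h₂ : Nonempty (SSet.Homotopy f₀ f₂)) :
    Nonempty (SSet.Homotopy f₁ f₂) := by
  rw [nonempty_homotopy_iff] at *
  obtain ⟨e₁, h₁, h₁'⟩ := h₁
  obtain ⟨e₂, h₂, h₂'⟩ := h₂
  obtain ⟨t, ht, ht', -⟩ := exists_triangle_lift (terminal.from K) e₁ e₂ (terminal.from _)
    (h₁.trans h₂.symm) (by subsingleton) (by subsingleton)
  -- The given homotopies are the edges `01` and `02` of the triangle `t`; its edge `12` is the one
  -- sought.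
  refine ⟨X ◁ stdSimplex.δ 0 ≫ t, ?_, ?_⟩
  · rw [← Category.assoc, ← ι₁_whiskerLeft_δ_two, Category.assoc, ht, h₁']
  · rw [← Category.assoc, ← ι₁_whiskerLeft_δ_one, Category.assoc, ht', h₂']

/-- Filling horns against constant homotopies gives symmetry, so one homotopy replaces a generated
chain. -/
lemma sameHomotopyClass_iff {X K : SSet.{u}} [KanComplex K] {f g : X ⟶ K} :
    SameHomotopyClass f g ↔ Nonempty (SSet.Homotopy f g) := by
  have refl (f : X ⟶ K) : Nonempty (SSet.Homotopy f f) :=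
    (nonempty_homotopy_iff _ _).2 ⟨fst _ _ ≫ f, rfl, rfl⟩
  have symm {f g : X ⟶ K} (h : Nonempty (SSet.Homotopy f g)) : Nonempty (SSet.Homotopy g f) :=
    nonempty_homotopy_of_kanComplex h (refl _)
  refine ⟨fun h ↦ ?_, fun h ↦ .rel _ _ h⟩
  induction h with
  | rel _ _ h => exact h
  | refl _ => exact refl _
  | symm _ _ _ h => exact symm h
  | trans _ _ _ _ _ h h' => exact nonempty_homotopy_of_kanComplex (symm h) h'

namespace SameHomotopyClass

variable {X Y K L : SSet.{u}}

lemma refl (f : X ⟶ K) : SameHomotopyClass f f := Relation.EqvGen.refl _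

lemma symm {f g : X ⟶ K} (h : SameHomotopyClass f g) : SameHomotopyClass g f :=
  Relation.EqvGen.symm _ _ h

lemma trans {f g k : X ⟶ K} (h : SameHomotopyClass f g) (h' : SameHomotopyClass g k) :
    SameHomotopyClass f k := Relation.EqvGen.trans _ _ _ h h'

lemma precomp {f g : X ⟶ K} (h : SameHomotopyClass f g) (a : Y ⟶ X) :
    SameHomotopyClass (a ≫ f) (a ≫ g) := by
  induction h with
  | rel _ _ h =>
    obtain ⟨h, h₀, h₁⟩ := (nonempty_homotopy_iff _ _).1 h
    exact .rel _ _ ((nonempty_homotopy_iff _ _).2 ⟨a ▷ _ ≫ h, by simp [h₀], by simp [h₁]⟩)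
  | refl _ => exact .refl _
  | symm _ _ _ h => exact h.symm
  | trans _ _ _ _ _ h h' => exact h.trans h'

lemma postcomp {f g : X ⟶ K} (h : SameHomotopyClass f g) (a : K ⟶ L) :
    SameHomotopyClass (f ≫ a) (g ≫ a) := by
  induction h with
  | rel _ _ h =>
    obtain ⟨h, h₀, h₁⟩ := (nonempty_homotopy_iff _ _).1 h
    exact .rel _ _ ((nonempty_homotopy_iff _ _).2
      ⟨h ≫ a, by rw [reassoc_of% h₀], by rw [reassoc_of% h₁]⟩)
  | refl _ => exact .refl _
  | symm _ _ _ h => exact h.symm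
  | trans _ _ _ _ _ h h' => exact h.trans h'

end SameHomotopyClass

/-- A fibration with a section `s` such that `p ≫ s` is homotopic to the identity has a
fibrewise homotopy from `p ≫ s` to the identity. -/
lemma exists_fibrewise_homotopy {E B : SSet.{u}} (p : E ⟶ B) [Fibration p] (s : B ⟶ E)
    (hs : s ≫ p = 𝟙 B) (H : E ⊗ Δ[1] ⟶ E) (h₀ : ι₀ ≫ H = p ≫ s) (h₁ : ι₁ ≫ H = 𝟙 E) :
    ∃ G : E ⊗ Δ[1] ⟶ E, ι₀ ≫ G = p ≫ s ∧ ι₁ ≫ G = 𝟙 E ∧ G ≫ p = fst _ _ ≫ p := by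
  -- The triangle has edges `H ≫ p ≫ s` and `H` out of vertex `0`, over a degenerate triangle whose
  -- edge `12` is constant. The edge `12` of the lift is thus fibrewise.
  obtain ⟨t, ht, ht', htp⟩ := exists_triangle_lift p (H ≫ p ≫ s) H
    (E ◁ stdSimplex.σ 1 ≫ H ≫ p) (by rw [reassoc_of% h₀, reassoc_of% hs, h₀])
    (by
      rw [Category.assoc, Category.assoc, hs, Category.comp_id, ← whiskerLeft_comp_assoc,
        show (2 : Fin 3) = Fin.succ 1 from rfl, stdSimplex.δ_comp_σ_succ]
      simp)
    (by
      rw [← whiskerLeft_comp_assoc,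
        show (1 : Fin 3) = Fin.castSucc 1 from rfl, stdSimplex.δ_comp_σ_self]
      simp)
  refine ⟨E ◁ stdSimplex.δ 0 ≫ t, ?_, ?_, ?_⟩
  · rw [← Category.assoc, ← ι₁_whiskerLeft_δ_two, Category.assoc, ht, reassoc_of% h₁]
  · rw [← Category.assoc, ← ι₁_whiskerLeft_δ_one, Category.assoc, ht', h₁]
  · rw [Category.assoc, htp, ← whiskerLeft_comp_assoc,
      show (stdSimplex.δ 0 : Δ[1] ⟶ Δ[2]) ≫ stdSimplex.σ 1 = stdSimplex.σ 0 ≫ stdSimplex.δ 0 from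
        stdSimplex.δ_comp_σ_of_le (i := 0) (j := 0) (by simp)]
    rw [whiskerLeft_comp_assoc, reassoc_of% whiskerLeft_δ_zero E, reassoc_of% h₁]
    simp

/-- A fibration which is a homotopy equivalence in the sense of `exists_fibrewise_homotopy`
has the right lifting property with respect to monomorphisms. -/
lemma exists_lift_of_section {E B M N : SSet.{u}} (p : E ⟶ B) [Fibration p] (s : B ⟶ E)
    (hs : s ≫ p = 𝟙 B) (H : E ⊗ Δ[1] ⟶ E) (h₀ : ι₀ ≫ H = p ≫ s) (h₁ : ι₁ ≫ H = 𝟙 E)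
    (m : M ⟶ N) [Mono m] (a : M ⟶ E) (b : N ⟶ B) (w : a ≫ p = m ≫ b) :
    ∃ l : N ⟶ E, m ≫ l = a ∧ l ≫ p = b := by
  obtain ⟨G, g₀, g₁, gp⟩ := exists_fibrewise_homotopy p s hs H h₀ h₁
  -- The map `b ≫ s` lifts `b` but restricts to `a ≫ p ≫ s`. Transport along `G` over a constant
  -- homotopy in the base corrects this to `a`.
  obtain ⟨l, -, l₁, lp⟩ := exists_homotopy_lift₀ p m (b ≫ s) (a ▷ _ ≫ G) (fst _ _ ≫ b)
    (by rw [ι₀_comp_assoc, g₀, reassoc_of% w])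
    (by rw [Category.assoc, gp, whiskerRight_fst_assoc, whiskerRight_fst_assoc, w])
    (by rw [← Category.assoc, ι₀_fst, Category.assoc, hs]; simp)
  refine ⟨ι₁ ≫ l, ?_, ?_⟩
  · rw [← ι₁_comp_assoc, l₁, ι₁_comp_assoc, g₁, Category.comp_id]
  · rw [Category.assoc, lp, ← Category.assoc, ι₁_fst, Category.id_comp]

/-! ### Formal properties of weak equivalences -/

namespace IsSSetWeakEquivalence

variable {W X Y Z : SSet.{u}}

lemma comp {f : X ⟶ Y} {g : Y ⟶ Z} (hf : IsSSetWeakEquivalence f)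
    (hg : IsSSetWeakEquivalence g) : IsSSetWeakEquivalence (f ≫ g) := by
  refine fun K hK ↦ ⟨fun a b h ↦ ?_, fun a ↦ ?_⟩
  · simp only [Category.assoc] at h
    exact (hg K hK).1 _ _ ((hf K hK).1 _ _ h)
  · obtain ⟨b, hb⟩ := (hf K hK).2 a
    obtain ⟨c, hc⟩ := (hg K hK).2 b
    exact ⟨c, by simpa using (hc.precomp f).trans hb⟩

/-- The two-out-of-six property, for the middle morphism. -/
lemma of_comp_of_comp {f : W ⟶ X} {g : X ⟶ Y} {h : Y ⟶ Z} (hfg : IsSSetWeakEquivalence (f ≫ g))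
    (hgh : IsSSetWeakEquivalence (g ≫ h)) : IsSSetWeakEquivalence g := by
  refine fun K hK ↦ ⟨fun a b r ↦ (hfg K hK).1 _ _ ?_, fun a ↦ ?_⟩
  · simpa using r.precomp f
  · obtain ⟨b, hb⟩ := (hgh K hK).2 a
    exact ⟨h ≫ b, by simpa using hb⟩

lemma of_homotopy_inverse {f : X ⟶ Y} {g : Y ⟶ X} (hfg : SameHomotopyClass (f ≫ g) (𝟙 X))
    (hgf : SameHomotopyClass (g ≫ f) (𝟙 Y)) : IsSSetWeakEquivalence f := by
  refine fun K hK ↦ ⟨fun a b r ↦ ?_, fun a ↦ ⟨g ≫ a, by simpa using hfg.postcomp a⟩⟩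
  have ha := hgf.postcomp a
  have hb := hgf.postcomp b
  simp only [Category.assoc, Category.id_comp] at ha hb
  exact (ha.symm.trans (r.precomp g)).trans hb

lemma of_isIso (f : X ⟶ Y) [IsIso f] : IsSSetWeakEquivalence f :=
  of_homotopy_inverse (g := inv f) (by simpa using .refl _) (by simpa using .refl _)

lemma of_precomp {f : X ⟶ Y} {g : Y ⟶ Z} (hf : IsSSetWeakEquivalence f)
    (hfg : IsSSetWeakEquivalence (f ≫ g)) : IsSSetWeakEquivalence g := by
  refine fun K hK ↦ ⟨fun a b r ↦ (hfg K hK).1 _ _ ?_, fun a ↦ ?_⟩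
  · simpa using r.precomp f
  · obtain ⟨b, hb⟩ := (hfg K hK).2 (f ≫ a)
    exact ⟨b, (hf K hK).1 _ _ (by simpa using hb)⟩

lemma of_postcomp {f : X ⟶ Y} {g : Y ⟶ Z} (hg : IsSSetWeakEquivalence g)
    (hfg : IsSSetWeakEquivalence (f ≫ g)) : IsSSetWeakEquivalence f := by
  refine fun K hK ↦ ⟨fun a b r ↦ ?_, fun a ↦ ?_⟩
  · obtain ⟨a', ha⟩ := (hg K hK).2 a
    obtain ⟨b', hb⟩ := (hg K hK).2 b
    have hr := ((ha.precomp f).trans r).trans (hb.precomp f).symm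
    simp only [← Category.assoc] at hr
    exact (ha.symm.trans (((hfg K hK).1 a' b' hr).precomp g)).trans hb
  · obtain ⟨b, hb⟩ := (hfg K hK).2 a
    exact ⟨g ≫ b, by simpa using hb⟩

/-- A retract up to homotopy of a weak equivalence is a weak equivalence. -/
lemma of_homotopy_retract {X' Y' : SSet.{u}} {i : X ⟶ X'} {j : Y ⟶ Y'}
    (hi : IsSSetWeakEquivalence i) (a : Y ⟶ X) (a' : Y' ⟶ X') (b : X ⟶ Y) (b' : X' ⟶ Y')
    (ha : j ≫ a' = a ≫ i) (hb : i ≫ b' = b ≫ j) (h : SameHomotopyClass (a ≫ b) (𝟙 Y))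
    (h' : SameHomotopyClass (a' ≫ b') (𝟙 Y')) : IsSSetWeakEquivalence j := by
  refine fun K hK ↦ ⟨fun g g' r ↦ ?_, fun g ↦ ?_⟩
  · have hg := h'.postcomp g
    have hg' := h'.postcomp g'
    simp only [Category.assoc, Category.id_comp] at hg hg'
    have hr := r.precomp b
    rw [← reassoc_of% hb, ← reassoc_of% hb] at hr
    exact (hg.symm.trans (((hi K hK).1 _ _ hr).precomp a')).trans hg'
  · obtain ⟨k, hk⟩ := (hi K hK).2 (b ≫ g)
    refine ⟨a' ≫ k, ?_⟩
    have := h.postcomp g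
    simp only [Category.assoc, Category.id_comp] at this
    rw [reassoc_of% ha]
    exact (hk.precomp a).trans this

end IsSSetWeakEquivalence

/-! ### Products with weak equivalences -/

/-- Currying preserves and reflects homotopy. -/
lemma sameHomotopyClass_curry_iff {S X K : SSet.{u}} [KanComplex K] {f g : S ⊗ X ⟶ K} :
    SameHomotopyClass (MonoidalClosed.curry f) (MonoidalClosed.curry g) ↔
      SameHomotopyClass f g := by
  have e₀ : S ◁ ι₀ = (ι₀ : S ⊗ X ⟶ _) ≫ (α_ S X Δ[1]).hom := rfl
  have e₁ : S ◁ ι₁ = (ι₁ : S ⊗ X ⟶ _) ≫ (α_ S X Δ[1]).hom := rfl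
  rw [sameHomotopyClass_iff, sameHomotopyClass_iff, nonempty_homotopy_iff, nonempty_homotopy_iff]
  constructor
  · rintro ⟨h, h₀, h₁⟩
    refine ⟨(α_ S X Δ[1]).hom ≫ MonoidalClosed.uncurry h, ?_, ?_⟩
    · rw [← reassoc_of% e₀, ← MonoidalClosed.uncurry_natural_left, h₀,
        MonoidalClosed.uncurry_curry]
    · rw [← reassoc_of% e₁, ← MonoidalClosed.uncurry_natural_left, h₁,
        MonoidalClosed.uncurry_curry]
  · rintro ⟨h, h₀, h₁⟩
    refine ⟨MonoidalClosed.curry ((α_ S X Δ[1]).inv ≫ h), ?_, ?_⟩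
    · rw [← MonoidalClosed.curry_natural_left, reassoc_of% e₀, Iso.hom_inv_id_assoc, h₀]
    · rw [← MonoidalClosed.curry_natural_left, reassoc_of% e₁, Iso.hom_inv_id_assoc, h₁]

namespace IsSSetWeakEquivalence

variable {X Y : SSet.{u}} {i : X ⟶ Y}

/-- Maps `S ⊗ X ⟶ K` are maps from `X` to the internal hom from `S` to `K`, which is again a Kan
complex. -/
lemma whiskerLeft (hi : IsSSetWeakEquivalence i) (S : SSet.{u}) :
    IsSSetWeakEquivalence (S ◁ i) := by
  refine fun K hK ↦ ⟨fun a b r ↦ ?_, fun a ↦ ?_⟩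
  · rw [← sameHomotopyClass_curry_iff, MonoidalClosed.curry_natural_left,
      MonoidalClosed.curry_natural_left] at r
    rw [← sameHomotopyClass_curry_iff]
    exact (hi _ inferInstance).1 _ _ r
  · obtain ⟨b, hb⟩ := (hi _ inferInstance).2 (MonoidalClosed.curry a)
    refine ⟨MonoidalClosed.uncurry b, ?_⟩
    rwa [← sameHomotopyClass_curry_iff, MonoidalClosed.curry_natural_left,
      MonoidalClosed.curry_uncurry]

lemma whiskerRight (hi : IsSSetWeakEquivalence i) (S : SSet.{u}) :
    IsSSetWeakEquivalence (i ▷ S) := by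
  have : i ▷ S = (β_ X S).hom ≫ S ◁ i ≫ (β_ Y S).inv := by simp
  rw [this]
  exact (of_isIso _).comp ((hi.whiskerLeft S).comp (of_isIso _))

/-- A map to a Kan complex extends along a monomorphism which is a weak equivalence. -/
lemma exists_extension [Mono i] (hi : IsSSetWeakEquivalence i) {K : SSet.{u}} [KanComplex K]
    (f : X ⟶ K) : ∃ g : Y ⟶ K, i ≫ g = f := by
  obtain ⟨g, hg⟩ := (hi K inferInstance).2 f
  obtain ⟨h, h₀, h₁⟩ := (nonempty_homotopy_iff _ _).1 (sameHomotopyClass_iff.1 hg)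
  -- Homotopy extension along `i` turns the extension up to homotopy into a strict one.
  obtain ⟨l, -, hl, -⟩ := exists_homotopy_lift₀ (terminal.from K) i g h (terminal.from _) h₀
    (by subsingleton) (by subsingleton)
  exact ⟨ι₁ ≫ l, by rw [← ι₁_comp_assoc, hl, h₁]⟩

end IsSSetWeakEquivalence

instance mono_whiskerRight {X Y : SSet.{u}} (i : X ⟶ Y) [Mono i] (Z : SSet.{u}) :
    Mono (i ▷ Z) where
  right_cancellation f g h := by
    have h₁ := h =≫ fst _ _
    have h₂ := h =≫ snd _ _
    simp only [Category.assoc, whiskerRight_fst, whiskerRight_snd] at h₁ h₂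
    rw [← Category.assoc, ← Category.assoc, cancel_mono] at h₁
    exact CartesianMonoidalCategory.hom_ext _ _ h₁ h₂

/-! ### Strict extension properties and countable unions -/

/-- The extension property of `i` against all Kan complexes, relative to monomorphisms:
the pushout-products of `i` with monomorphisms have the left lifting property with respect to
Kan complexes. -/
def RelativeExtensionProperty {X Y : SSet.{u}} (i : X ⟶ Y) : Prop :=
  ∀ (K : SSet.{u}) (_ : KanComplex K) (S T : SSet.{u}) (m : S ⟶ T) (_ : Mono m)
    (a : X ⊗ T ⟶ K) (b : Y ⊗ S ⟶ K), X ◁ m ≫ a = i ▷ S ≫ b →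
      ∃ c : Y ⊗ T ⟶ K, i ▷ T ≫ c = a ∧ Y ◁ m ≫ c = b

lemma IsSSetWeakEquivalence.relativeExtensionProperty {X Y : SSet.{u}} {i : X ⟶ Y} [Mono i]
    (hi : IsSSetWeakEquivalence i) : RelativeExtensionProperty i := by
  intro K _ S T m _ a b w
  let p := (MonoidalClosed.pre i).app K
  -- Extending the evaluation map along `i` gives, after currying, a section of the restriction map
  -- `p`.
  obtain ⟨s, hs⟩ := (hi.whiskerRight ((ihom X).obj K)).exists_extension
    (MonoidalClosed.uncurry (𝟙 _))
  have hsp : MonoidalClosed.curry s ≫ p = 𝟙 _ := by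
    rw [MonoidalClosed.curry_pre_app, hs, MonoidalClosed.curry_uncurry]
  have hps : SameHomotopyClass (p ≫ MonoidalClosed.curry s) (𝟙 _) := by
    rw [← MonoidalClosed.curry_uncurry (p ≫ MonoidalClosed.curry s),
      ← MonoidalClosed.curry_uncurry (𝟙 _), sameHomotopyClass_curry_iff]
    -- Both maps have the same restriction along `i`, which detects homotopy after taking products.
    refine (hi.whiskerRight _ K inferInstance).1 _ _ ?_
    rw [← MonoidalClosed.uncurry_pre_app, ← MonoidalClosed.uncurry_pre_app]
    change SameHomotopyClass (MonoidalClosed.uncurry ((p ≫ MonoidalClosed.curry s) ≫ p)) _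
    rw [Category.assoc, hsp, Category.comp_id, Category.id_comp]
    exact .refl _
  obtain ⟨H, h₀, h₁⟩ := (nonempty_homotopy_iff _ _).1 (sameHomotopyClass_iff.1 hps)
  obtain ⟨l, hl, hl'⟩ := exists_lift_of_section p _ hsp H h₀ h₁ m (MonoidalClosed.curry b)
    (MonoidalClosed.curry a) (by
      rw [MonoidalClosed.curry_pre_app, ← w, MonoidalClosed.curry_natural_left])
  refine ⟨MonoidalClosed.uncurry l, ?_, ?_⟩
  · rw [← MonoidalClosed.uncurry_pre_app]
    change MonoidalClosed.uncurry (l ≫ p) = a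
    rw [hl', MonoidalClosed.uncurry_curry]
  · rw [← MonoidalClosed.uncurry_natural_left, hl, MonoidalClosed.uncurry_curry]

lemma RelativeExtensionProperty.exists_extension {X Y : SSet.{u}} {i : X ⟶ Y}
    (hi : RelativeExtensionProperty i) {K : SSet.{u}} [hK : KanComplex K] (f : X ⟶ K) :
    ∃ g : Y ⟶ K, i ≫ g = f := by
  -- Relative to the empty subcomplex of a point, the property is plain extension.
  obtain ⟨c, hc, -⟩ := hi K hK _ _ (⊥ : (Δ[0] : SSet.{u}).Subcomplex).ι inferInstance
    (fst _ _ ≫ f) { app n := ↾fun x ↦ (x.2.2 : False).elim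
                    naturality _ _ _ := by ext x; exact (x.2.2 : False).elim }
    (by ext n x; exact (x.2.2 : False).elim)
  refine ⟨lift (𝟙 _) (SSet.const (stdSimplex.obj₀Equiv.symm 0)) ≫ c, ?_⟩
  have : i ≫ lift (𝟙 Y) (SSet.const (stdSimplex.obj₀Equiv.symm 0) : Y ⟶ Δ[0]) =
      lift (𝟙 X) (SSet.const (stdSimplex.obj₀Equiv.symm 0)) ≫ i ▷ _ := rfl
  rw [reassoc_of% this, hc]
  simp

/-- The simplicial set with two vertices and no other nondegenerate simplices. -/
def twoPoints : SSet.{u} := (Functor.const _).obj (ULift.{u} Bool)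

/-- The inclusion of the two endpoints of `Δ[1]`. -/
def endpoints : twoPoints.{u} ⟶ Δ[1] where
  app n := ↾fun b ↦ (SSet.stdSimplex.objMk (OrderHom.const _ (if b.down then 1 else 0)) :
    Δ[1] _⦋n.unop.len⦌)
  naturality _ _ _ := rfl

instance : Mono endpoints.{u} := by
  rw [NatTrans.mono_iff_mono_app]
  rintro ⟨n⟩
  rw [mono_iff_injective]
  rintro ⟨a⟩ ⟨b⟩ h
  have h' : (if a then 1 else 0 : Fin 2) = if b then 1 else 0 :=
    congr_arg (fun x : Δ[1] _⦋n.len⦌ ↦ x 0) h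
  cases a <;> cases b <;> first | rfl | exact absurd h' (by decide)

/-- The map from `Y ⊗ twoPoints` given by a pair of maps. -/
def pairMap {Y K : SSet.{u}} (g g' : Y ⟶ K) : Y ⊗ twoPoints ⟶ K where
  app n := ↾fun x ↦ if x.2.down then g'.app n x.1 else g.app n x.1
  naturality n m f := by
    ext ⟨x, ⟨b⟩⟩
    cases b
    · exact NatTrans.naturality_apply g f x
    · exact NatTrans.naturality_apply g' f x

lemma RelativeExtensionProperty.isSSetWeakEquivalence {X Y : SSet.{u}} {i : X ⟶ Y}
    (hi : RelativeExtensionProperty i) : IsSSetWeakEquivalence i := by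
  refine fun K hK ↦ ⟨fun g g' r ↦ ?_, fun f ↦ ?_⟩
  · rw [sameHomotopyClass_iff, nonempty_homotopy_iff] at r ⊢
    obtain ⟨h, h₀, h₁⟩ := r
    -- Relative to the endpoints of `Δ[1]`, the property extends a homotopy from `X` to `Y` with
    -- prescribed ends.
    obtain ⟨c, -, hc⟩ := hi K hK _ _ endpoints inferInstance h (pairMap g g') (by
      ext n ⟨x, ⟨b⟩⟩
      cases b
      · exact ConcreteCategory.congr_hom (congr_app h₀ n) x
      · exact ConcreteCategory.congr_hom (congr_app h₁ n) x)
    refine ⟨c, ?_, ?_⟩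
    · ext n y
      exact ConcreteCategory.congr_hom (congr_app hc n) (show (Y ⊗ twoPoints).obj n from (y, ⟨false⟩))
    · ext n y
      exact ConcreteCategory.congr_hom (congr_app hc n) (show (Y ⊗ twoPoints).obj n from (y, ⟨true⟩))
  · obtain ⟨g, rfl⟩ := hi.exists_extension f
    exact ⟨g, .refl _⟩

/-- Compatible maps on the stages of an increasing union glue. -/
lemma exists_glue {X : ℕ → SSet.{u}} {Y K : SSet.{u}} (t : ∀ n, X n ⟶ X (n + 1))
    (j : ∀ n, X n ⟶ Y) [∀ n, Mono (j n)] (hj : ∀ n, t n ≫ j (n + 1) = j n)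
    (hY : ∀ k (y : Y.obj k), ∃ n x, (j n).app k x = y)
    (f : ∀ n, X n ⟶ K) (hf : ∀ n, t n ≫ f (n + 1) = f n) :
    ∃ g : Y ⟶ K, ∀ n, j n ≫ g = f n := by
  have inj (n k) : Function.Injective ((j n).app k) := by
    rw [← mono_iff_injective]; infer_instance
  have push (n d : ℕ) (k) (x : (X n).obj k) :
      ∃ x', (j (n + d)).app k x' = (j n).app k x ∧ (f (n + d)).app k x' = (f n).app k x := by
    induction d with
    | zero => exact ⟨x, rfl, rfl⟩
    | succ d ih =>
      obtain ⟨x', h₁, h₂⟩ := ih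
      refine ⟨(t (n + d)).app k x', ?_, ?_⟩
      · rw [← h₁]; exact ConcreteCategory.congr_hom (congr_app (hj (n + d)) k) x'
      · rw [← h₂]; exact ConcreteCategory.congr_hom (congr_app (hf (n + d)) k) x'
  -- Two representatives of a simplex agree once pushed to a common stage, because each `j n` is
  -- injective.
  have well (n m k) (x : (X n).obj k) (x' : (X m).obj k)
      (h : (j n).app k x = (j m).app k x') : (f n).app k x = (f m).app k x' := by
    wlog hnm : n ≤ m generalizing n m
    · exact (this m n x' x h.symm (by omega)).symm
    obtain ⟨d, rfl⟩ := Nat.exists_eq_add_of_le hnm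
    obtain ⟨x'', h₁, h₂⟩ := push n d k x
    obtain rfl := inj _ _ (h₁.trans h)
    exact h₂.symm
  choose N x hx using hY
  refine ⟨{ app k := ↾fun y ↦ (f (N k y)).app k (x k y), naturality k l φ := ?_ }, fun n ↦ ?_⟩
  · ext y
    refine (well _ _ _ _ ((X (N k y)).map φ (x k y)) ?_).trans
      (NatTrans.naturality_apply (f (N k y)) φ (x k y))
    rw [hx, NatTrans.naturality_apply (j (N k y)) φ (x k y), hx]
    rfl
  · ext k y
    exact well _ _ _ _ _ (hx _ _)

/-- The relative extension property passes to countable increasing unions. -/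
lemma RelativeExtensionProperty.of_iUnion {X : ℕ → SSet.{u}} {Y : SSet.{u}}
    {t : ∀ n, X n ⟶ X (n + 1)} (ht : ∀ n, RelativeExtensionProperty (t n))
    (j : ∀ n, X n ⟶ Y) [∀ n, Mono (j n)] (hj : ∀ n, t n ≫ j (n + 1) = j n)
    (hY : ∀ k (y : Y.obj k), ∃ n x, (j n).app k x = y) :
    RelativeExtensionProperty (j 0) := by
  intro K hK S T m hm a b w
  -- Partial solutions over the `n`th stage; each is chosen to extend its predecessor strictly, so
  -- they glue.
  let Stage (n : ℕ) := {c : X n ⊗ T ⟶ K // X n ◁ m ≫ c = j n ▷ S ≫ b}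
  have step (n : ℕ) (c : Stage n) : ∃ c' : Stage (n + 1), t n ▷ T ≫ c'.1 = c.1 := by
    obtain ⟨c', h₁, h₂⟩ := ht n K hK S T m hm c.1 (j (n + 1) ▷ S ≫ b)
      (by rw [c.2, ← comp_whiskerRight_assoc, hj])
    exact ⟨⟨c', h₂⟩, h₁⟩
  choose next hnext using step
  let c (n : ℕ) : Stage n := Nat.rec ⟨a, w⟩ next n
  obtain ⟨g, hg⟩ := exists_glue (fun n ↦ t n ▷ T) (fun n ↦ j n ▷ T)
    (fun n ↦ by rw [← comp_whiskerRight, hj])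
    (fun k ⟨y, s⟩ ↦ by
      obtain ⟨n, x, rfl⟩ := hY k y
      exact ⟨n, ⟨x, s⟩, rfl⟩)
    (fun n ↦ (c n).1) (fun n ↦ hnext n (c n))
  refine ⟨g, hg 0, ?_⟩
  ext k ⟨y, s⟩
  obtain ⟨n, x, rfl⟩ := hY k y
  have h : X n ◁ m ≫ j n ▷ T ≫ g = j n ▷ S ≫ b := by rw [hg n]; exact (c n).2
  exact ConcreteCategory.congr_hom (congr_app h k) ⟨x, s⟩

/-- A countable increasing union of weak equivalences is a weak equivalence. -/
lemma IsSSetWeakEquivalence.of_iUnion {X : ℕ → SSet.{u}} {Y : SSet.{u}}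
    {t : ∀ n, X n ⟶ X (n + 1)} (ht : ∀ n, IsSSetWeakEquivalence (t n))
    (j : ∀ n, X n ⟶ Y) [∀ n, Mono (j n)] (hj : ∀ n, t n ≫ j (n + 1) = j n)
    (hY : ∀ k (y : Y.obj k), ∃ n x, (j n).app k x = y) :
    IsSSetWeakEquivalence (j 0) :=
  RelativeExtensionProperty.isSSetWeakEquivalence (.of_iUnion (fun n ↦
    have : Mono (t n) := mono_of_mono_fac (hj n)
    (ht n).relativeExtensionProperty) j hj hY)

/-! ### Natural transformations as homotopies -/

section NaturalTransformations

variable {C D : Type u} [Category.{v} C] [Category.{v} D] {F G : C ⥤ D}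

/-- The homotopy between nerves induced by a natural transformation. -/
def nerveHomotopy (τ : F ⟶ G) : nerve C ⊗ Δ[1] ⟶ nerve D where
  app _ := ↾fun x ↦ (stdSimplex.asOrderHom x.2).monotone.functor.prod' x.1 ⋙
    Functor.uncurry.obj (ComposableArrows.mk₁ τ)
  naturality _ _ _ := rfl

lemma sameHomotopyClass_of_natTrans (τ : F ⟶ G) :
    SameHomotopyClass (nerveMap F) (nerveMap G) := by
  refine .rel _ _ ((nonempty_homotopy_iff _ _).2 ⟨nerveHomotopy τ, ?_, ?_⟩)
  · ext n x
    refine Functor.hext (fun _ ↦ rfl) (fun i j f ↦ heq_of_eq ?_)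
    have e (a : (0 : Fin 2) ⟶ 0) : (ComposableArrows.mk₁ τ).map a = 𝟙 F := by
      rw [Subsingleton.elim a (𝟙 _)]; exact (ComposableArrows.mk₁ τ).map_id 0
    exact (congr_arg (fun t : F ⟶ F ↦ t.app (x.obj i) ≫ F.map (x.map f)) (e _)).trans
      (Category.id_comp _)
  · ext n x
    refine Functor.hext (fun _ ↦ rfl) (fun i j f ↦ heq_of_eq ?_)
    have e (a : (1 : Fin 2) ⟶ 1) : (ComposableArrows.mk₁ τ).map a = 𝟙 G := by
      rw [Subsingleton.elim a (𝟙 _)]; exact (ComposableArrows.mk₁ τ).map_id 1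
    exact (congr_arg (fun t : G ⟶ G ↦ t.app (x.obj i) ≫ G.map (x.map f)) (e _)).trans
      (Category.id_comp _)

lemma sameHomotopyClass_of_zigzag (h : Zigzag F G) :
    SameHomotopyClass (nerveMap F) (nerveMap G) := by
  induction h with
  | refl => exact .refl _
  | tail _ h ih =>
    obtain ⟨⟨τ⟩⟩ | ⟨⟨τ⟩⟩ := h
    · exact ih.trans (sameHomotopyClass_of_natTrans τ)
    · exact ih.trans (sameHomotopyClass_of_natTrans τ).symm

end NaturalTransformations

/-! ### Components detected by a two-point Kan complex -/

lemma app_map_twoPoints {X : SSet.{u}} (g : X ⟶ twoPoints) {m n : SimplexCategoryᵒᵖ}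
    (f : m ⟶ n) (x : X.obj m) : g.app n (X.map f x) = g.app m x :=
  NatTrans.naturality_apply g f x

lemma yonedaEquiv_δ_comp_twoPoints {n : ℕ} (j : Fin (n + 2)) (g : Δ[n + 1] ⟶ twoPoints.{u}) :
    SSet.yonedaEquiv (stdSimplex.δ j ≫ g) = SSet.yonedaEquiv g := by
  exact app_map_twoPoints g (SimplexCategory.δ j).op (SSet.yonedaEquiv (𝟙 _))

instance : KanComplex twoPoints.{u} := by
  rw [KanComplex.iff]
  intro n i f hf
  -- For `n = 0` the horn has one face. Otherwise two faces meet in a common face, where the value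
  -- is the same.
  have key (j k : Fin (n + 2)) (hj : j ≠ i) (hk : k ≠ i) (hjk : j < k) :
      SSet.yonedaEquiv (f j hj) = SSet.yonedaEquiv (f k hk) := by
    obtain _ | n := n
    · grind
    · have := congr_arg SSet.yonedaEquiv (hf j k hj hk hjk)
      rwa [yonedaEquiv_δ_comp_twoPoints, yonedaEquiv_δ_comp_twoPoints] at this
  obtain ⟨k, hk⟩ : ∃ k : Fin (n + 2), k ≠ i := exists_ne i
  let g : Δ[n + 1] ⟶ twoPoints := SSet.const (X := Δ[n + 1]) (Y := twoPoints)
    (show ULift Bool from SSet.yonedaEquiv (f k hk))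
  refine ⟨g, fun j hj ↦ SSet.yonedaEquiv.injective ?_⟩
  rw [yonedaEquiv_δ_comp_twoPoints]
  change SSet.yonedaEquiv (f k hk) = _
  obtain h | rfl | h := lt_trichotomy j k
  · exact (key _ _ _ _ h).symm
  · rfl
  · exact key _ _ _ _ h

lemma eq_of_sameHomotopyClass {X : SSet.{u}} {g g' : X ⟶ twoPoints}
    (h : SameHomotopyClass g g') : g = g' := by
  rw [sameHomotopyClass_iff, nonempty_homotopy_iff] at h
  obtain ⟨h, rfl, rfl⟩ := h
  ext n x
  -- Both ends of the homotopy take the value on one edge: the degenerate edge at the first vertex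
  -- of `x` paired with the edge of `Δ[1]`.
  have key (i : Fin 2) : h.app n (x, SSet.stdSimplex.objMk (OrderHom.const _ i)) =
      h.app _ (X.map (SimplexCategory.const ⦋1⦌ n.unop 0).op x,
        SSet.stdSimplex.objMk OrderHom.id) := by
    refine (app_map_twoPoints h (SimplexCategory.const ⦋0⦌ n.unop 0).op _).symm.trans
      (Eq.trans (congr_arg (h.app (.op ⦋0⦌)) (Prod.ext ?_ ?_))
        (app_map_twoPoints h (SimplexCategory.const ⦋0⦌ ⦋1⦌ i).op _))
    · change X.map _ x = X.map _ (X.map _ x)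
      rw [← Functor.map_comp_apply, ← op_comp]
      rfl
    · rfl
  exact (key 0).trans (key 1).symm

section Components

variable {C D : Type u} [Category.{v} C] [Category.{v} D]

/-- The map from the nerve of a category defined by a predicate on its components. -/
def nerveToTwoPoints (χ : CategoryTheory.ConnectedComponents C → Bool) : nerve C ⟶ twoPoints where
  app n := ↾fun x ↦ ⟨χ (CategoryTheory.ConnectedComponents.mk (x.obj 0))⟩
  naturality n m f := by
    ext x
    exact congr_arg ULift.up (congr_arg χ (Quotient.sound
      (show Zigzag _ _ from Zigzag.of_inv (x.map (homOfLE (Fin.zero_le _))))))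

lemma app_mk₀_eq_of_zigzag (g : nerve C ⟶ twoPoints) {x y : C} (h : Zigzag x y) :
    (g.app (.op ⦋0⦌) (.mk₀ x)).down = (g.app (.op ⦋0⦌) (.mk₀ y)).down := by
  have step {x y : C} (f : x ⟶ y) :
      (g.app (.op ⦋0⦌) (.mk₀ x)).down = (g.app (.op ⦋0⦌) (.mk₀ y)).down := by
    have h₁ := app_map_twoPoints g (SimplexCategory.δ (0 : Fin 2)).op (.mk₁ f)
    have h₀ := app_map_twoPoints g (SimplexCategory.δ (1 : Fin 2)).op (.mk₁ f)
    have e₁ : (nerve C).map (SimplexCategory.δ (0 : Fin 2)).op (.mk₁ f) = .mk₀ y :=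
      ComposableArrows.ext₀ rfl
    have e₀ : (nerve C).map (SimplexCategory.δ (1 : Fin 2)).op (.mk₁ f) = .mk₀ x :=
      ComposableArrows.ext₀ rfl
    rw [e₁] at h₁
    rw [e₀] at h₀
    rw [h₀, h₁]
  induction h with
  | refl => rfl
  | tail _ h ih =>
    obtain ⟨⟨f⟩⟩ | ⟨⟨f⟩⟩ := h
    · exact ih.trans (step f)
    · exact ih.trans (step f).symm

open Classical in
/-- A functor whose nerve is a weak equivalence induces a bijection on components. -/
lemma IsNerveWeakEquivalence.bijective_mapConnectedComponents {F : C ⥤ D}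
    (hF : IsNerveWeakEquivalence F) : Function.Bijective F.mapConnectedComponents := by
  obtain ⟨inj, surj⟩ := hF twoPoints inferInstance
  constructor
  · intro a b h
    induction a using Quotient.inductionOn with | _ x
    induction b using Quotient.inductionOn with | _ y
    by_contra hxy
    -- The indicator of the component of `x` factors through `F`, strictly because homotopic maps to
    -- `twoPoints` are equal.
    obtain ⟨g, hg⟩ := surj (nerveToTwoPoints (fun c ↦ decide (c = CategoryTheory.ConnectedComponents.mk x)))
    have hg' := eq_of_sameHomotopyClass hg
    have e (z : C) : (g.app (.op ⦋0⦌) (.mk₀ (F.obj z))).down =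
        decide (CategoryTheory.ConnectedComponents.mk z = CategoryTheory.ConnectedComponents.mk x) := by
      have := ConcreteCategory.congr_hom (congr_app hg' (.op ⦋0⦌)) (.mk₀ z)
      rw [← nerveMap_app_mk₀]
      exact congr_arg ULift.down this
    have := app_mk₀_eq_of_zigzag g (Quotient.exact h)
    rw [e, e] at this
    simp at this
    exact hxy this.symm
  · intro c
    induction c using Quotient.inductionOn with | _ y
    by_contra hc
    -- If `F` misses the component of `y`, its indicator and the zero map agree after `F`, hence
    -- agree.
    have := eq_of_sameHomotopyClass (inj
      (nerveToTwoPoints (fun c ↦ decide (c = CategoryTheory.ConnectedComponents.mk y)))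
      (nerveToTwoPoints (fun _ ↦ false)) (by
        convert SameHomotopyClass.refl _ using 1
        ext n x
        refine congr_arg ULift.up (Eq.symm ?_)
        simp only [decide_eq_false_iff_not]
        intro h
        exact hc ⟨CategoryTheory.ConnectedComponents.mk (x.obj 0), h⟩))
    have := congr_arg ULift.down
      (ConcreteCategory.congr_hom (congr_app this (.op ⦋0⦌)) (ComposableArrows.mk₀ y))
    exact absurd this (show decide (CategoryTheory.ConnectedComponents.mk y =
      CategoryTheory.ConnectedComponents.mk y) ≠ false by simp)

end Components

end CoreHomotopy

namespace CoreHomotopy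

/-! ### Small subcategories, generation and unions -/

namespace Subcat

variable {C : Type u} [Category.{v} C]

/-- The arrows of a subcategory. -/
def arrows (I : Subcat C) : Set (Arrow C) := {a | I.hom a.hom}

lemma obj_iff (I : Subcat C) (x : C) : I.obj x ↔ I.hom (𝟙 x) :=
  ⟨I.id_mem x, I.source_mem _⟩

/-- Identities recover the objects, so a subcategory can be handled as one set of arrows. -/
lemma le_iff {I J : Subcat C} : I ≤ J ↔ I.arrows ⊆ J.arrows := by
  refine ⟨fun h a ha ↦ h.2 a.hom ha, fun h ↦ ?_⟩
  have hom {x y : C} (f : x ⟶ y) (hf : I.hom f) : J.hom f := h (a := Arrow.mk f) hf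
  exact ⟨fun x hx ↦ (J.obj_iff x).2 (hom _ ((I.obj_iff x).1 hx)), fun _ _ f hf ↦ hom f hf⟩

lemma le_refl (I : Subcat C) : I ≤ I := le_iff.2 subset_rfl

lemma le_trans {I J K : Subcat C} (h : I ≤ J) (h' : J ≤ K) : I ≤ K :=
  le_iff.2 ((le_iff.1 h).trans (le_iff.1 h'))

lemma small_arrows_iff (I : Subcat C) :
    Small.{w} I.arrows ↔ IsSmallCategory.{w} I.Carrier := by
  constructor
  · intro _
    refine ⟨small_of_injective (β := I.arrows)
      (f := fun x ↦ ⟨Arrow.mk (𝟙 x.1), I.id_mem x.1 x.2⟩) (fun x y h ↦ ?_), ⟨fun x y ↦ ?_⟩⟩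
    · exact Subtype.ext (congr_arg (fun a : I.arrows ↦ a.1.left) h)
    · refine small_of_injective (β := I.arrows) (f := fun f ↦ ⟨Arrow.mk f.1, f.2⟩)
        (fun f g h ↦ Subtype.ext ?_)
      exact Arrow.mk_injective _ _ (congr_arg Subtype.val h)
  · rintro ⟨_, _⟩
    refine small_of_surjective (α := Σ (x y : I.Carrier), x ⟶ y)
      (f := fun f ↦ ⟨Arrow.mk f.2.2.1, f.2.2.2⟩) ?_
    rintro ⟨a, ha⟩
    exact ⟨⟨⟨a.left, I.source_mem _ ha⟩, ⟨a.right, I.target_mem _ ha⟩, ⟨a.hom, ha⟩⟩, rfl⟩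

/-- The composites of pairs of arrows in a set. -/
def composites (S : Set (Arrow C)) : Set (Arrow C) :=
  {a | ∃ (x y z : C) (f : x ⟶ y) (g : y ⟶ z), Arrow.mk f ∈ S ∧ Arrow.mk g ∈ S ∧
    a = Arrow.mk (f ≫ g)}

instance small_composites (S : Set (Arrow C)) [Small.{w} S] : Small.{w} (composites S) := by
  refine small_of_surjective (α := {p : S × S // p.1.1.right = p.2.1.left})
    (f := fun p ↦ ⟨Arrow.mk (p.1.1.1.hom ≫ eqToHom p.2 ≫ p.1.2.1.hom),
      ⟨_, _, _, p.1.1.1.hom, eqToHom p.2 ≫ p.1.2.1.hom, p.1.1.2, ?_, rfl⟩⟩) ?_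
  · obtain ⟨⟨⟨⟨x, y, f⟩, hf⟩, ⟨⟨y', z, g⟩, hg⟩⟩, h⟩ := p
    obtain rfl : y = y' := h
    simpa using! hg
  · rintro ⟨a, x, y, z, f, g, hf, hg, rfl⟩
    exact ⟨⟨(⟨_, hf⟩, ⟨_, hg⟩), rfl⟩, by simp⟩

/-- The stages of the closure of a set of arrows under composition. -/
def closureStage (S : Set (Arrow C)) : ℕ → Set (Arrow C)
  | 0 => S
  | n + 1 => closureStage S n ∪ composites (closureStage S n)

lemma closureStage_mono (S : Set (Arrow C)) : Monotone (closureStage S) :=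
  monotone_nat_of_le_succ fun _ ↦ Set.subset_union_left

lemma small_closureStage (S : Set (Arrow C)) [Small.{w} S] (n : ℕ) :
    Small.{w} (closureStage S n) := by
  induction n with
  | zero => assumption
  | succ n _ => exact small_union _ _

/-- The identities of the endpoints of a set of arrows, and these arrows. -/
def withIdentities (S : Set (Arrow C)) : Set (Arrow C) :=
  S ∪ ((fun a : Arrow C ↦ Arrow.mk (𝟙 a.left)) '' S ∪
    (fun a : Arrow C ↦ Arrow.mk (𝟙 a.right)) '' S)

lemma withIdentities_endpoints {S : Set (Arrow C)} {a : Arrow C} (ha : a ∈ withIdentities S) :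
    Arrow.mk (𝟙 a.left) ∈ withIdentities S ∧ Arrow.mk (𝟙 a.right) ∈ withIdentities S := by
  obtain h | ⟨b, hb, rfl⟩ | ⟨b, hb, rfl⟩ := ha
  · exact ⟨.inr (.inl ⟨a, h, rfl⟩), .inr (.inr ⟨a, h, rfl⟩)⟩
  · exact ⟨.inr (.inl ⟨b, hb, rfl⟩), .inr (.inl ⟨b, hb, rfl⟩)⟩
  · exact ⟨.inr (.inr ⟨b, hb, rfl⟩), .inr (.inr ⟨b, hb, rfl⟩)⟩

/-- Composition creates no new endpoints, so adding identities once, at stage `0`, suffices. -/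
lemma closureStage_endpoints {S : Set (Arrow C)} {n : ℕ} {a : Arrow C}
    (ha : a ∈ closureStage (withIdentities S) n) :
    Arrow.mk (𝟙 a.left) ∈ withIdentities S ∧ Arrow.mk (𝟙 a.right) ∈ withIdentities S := by
  induction n generalizing a with
  | zero => exact withIdentities_endpoints ha
  | succ n ih =>
    obtain h | ⟨x, y, z, f, g, hf, hg, rfl⟩ := ha
    · exact ih h
    · exact ⟨(ih hf).1, (ih hg).2⟩

/-- The subcategory generated by a set of arrows. -/
def generate (S : Set (Arrow C)) : Subcat C where
  obj x := Arrow.mk (𝟙 x) ∈ withIdentities S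
  hom _ _ f := ∃ n, Arrow.mk f ∈ closureStage (withIdentities S) n
  source_mem _ := fun ⟨_, h⟩ ↦ (closureStage_endpoints h).1
  target_mem _ := fun ⟨_, h⟩ ↦ (closureStage_endpoints h).2
  id_mem _ h := ⟨0, h⟩
  comp_mem f g := fun ⟨n, hf⟩ ⟨m, hg⟩ ↦ ⟨max n m + 1, .inr ⟨_, _, _, f, g,
    closureStage_mono _ (le_max_left n m) hf, closureStage_mono _ (le_max_right n m) hg, rfl⟩⟩

lemma subset_generate (S : Set (Arrow C)) : S ⊆ (generate S).arrows :=
  fun _ ha ↦ ⟨0, .inl ha⟩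

lemma isSmallCategory_generate (S : Set (Arrow C)) [Small.{w} S] :
    IsSmallCategory.{w} (generate S).Carrier := by
  rw [← small_arrows_iff]
  have : Small.{w} (withIdentities S) := by
    unfold withIdentities; infer_instance
  have := small_closureStage.{w} (withIdentities S)
  have : (generate S).arrows = ⋃ n, closureStage (withIdentities S) n := by
    ext a
    simp only [Set.mem_iUnion]
    rfl
  rw [this]
  infer_instance

lemma monotone_arrows_of_le_succ {I : ℕ → Subcat C} (hI : ∀ n, I n ≤ I (n + 1)) :
    Monotone fun n ↦ (I n).arrows := monotone_nat_of_le_succ fun n ↦ le_iff.1 (hI n)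

/-- The union of an increasing sequence of subcategories. -/
def iUnion (I : ℕ → Subcat C) (hI : ∀ n, I n ≤ I (n + 1)) : Subcat C where
  obj x := ∃ n, (I n).obj x
  hom _ _ f := ∃ n, (I n).hom f
  source_mem _ := fun ⟨n, h⟩ ↦ ⟨n, (I n).source_mem _ h⟩
  target_mem _ := fun ⟨n, h⟩ ↦ ⟨n, (I n).target_mem _ h⟩
  id_mem _ := fun ⟨n, h⟩ ↦ ⟨n, (I n).id_mem _ h⟩
  comp_mem f g := fun ⟨n, hf⟩ ⟨m, hg⟩ ↦ ⟨max n m, (I _).comp_mem f g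
    (show Arrow.mk f ∈ (I _).arrows from monotone_arrows_of_le_succ hI (le_max_left n m) hf)
    (show Arrow.mk g ∈ (I _).arrows from monotone_arrows_of_le_succ hI (le_max_right n m) hg)⟩

section iUnion

variable (I : ℕ → Subcat C) (hI : ∀ n, I n ≤ I (n + 1))

lemma arrows_iUnion : (iUnion I hI).arrows = ⋃ n, (I n).arrows := by
  ext a
  simp only [Set.mem_iUnion]
  rfl

lemma le_iUnion (n : ℕ) : I n ≤ iUnion I hI := by
  rw [le_iff, arrows_iUnion]
  exact Set.subset_iUnion (fun n ↦ (I n).arrows) n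

lemma isSmallCategory_iUnion (h : ∀ n, IsSmallCategory.{w} (I n).Carrier) :
    IsSmallCategory.{w} (iUnion I hI).Carrier := by
  simp only [← small_arrows_iff] at h ⊢
  rw [arrows_iUnion]
  infer_instance

/-- A functor with finitely many arrows to a union of subcategories factors through one of them. -/
lemma exists_lift_iUnion {k : ℕ} (x : Fin (k + 1) ⥤ (iUnion I hI).Carrier) :
    ∃ (n : ℕ) (y : Fin (k + 1) ⥤ (I n).Carrier), y ⋙ inclusion (le_iUnion I hI n) = x := by
  have h (p : Fin (k + 1) × Fin (k + 1)) :
      ∃ n, ∀ f : p.1 ⟶ p.2, (I n).hom (x.map f).1 := by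
    by_cases hp : Nonempty (p.1 ⟶ p.2)
    · obtain ⟨f⟩ := hp
      obtain ⟨n, hn⟩ := (x.map f).2
      exact ⟨n, fun g ↦ by rwa [Subsingleton.elim g f]⟩
    · exact ⟨0, fun f ↦ (hp ⟨f⟩).elim⟩
  choose N hN using h
  -- There are finitely many pairs of vertices and at most one arrow for each, so one stage contains
  -- the whole simplex.
  let n := Finset.univ.sup N
  have hn {i j : Fin (k + 1)} (f : i ⟶ j) : (I n).hom (x.map f).1 :=
    show Arrow.mk (x.map f).1 ∈ (I n).arrows from
      monotone_arrows_of_le_succ hI (Finset.le_sup (Finset.mem_univ (i, j))) (hN (i, j) f)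
  exact ⟨n, { obj i := ⟨(x.obj i).1, (I n).source_mem _ (hn (𝟙 i))⟩
              map f := ⟨(x.map f).1, hn f⟩
              map_id i := Subtype.ext (congr_arg Subtype.val (x.map_id i) :)
              map_comp f g := Subtype.ext (congr_arg Subtype.val (x.map_comp f g) :) }, rfl⟩

end iUnion

lemma heq_of_inclusion_map_heq {I J : Subcat C} (h : I ≤ J) {a b a' b' : I.Carrier} (ha : a = a')
    (hb : b = b') {f : a ⟶ b} {g : a' ⟶ b'}
    (hfg : (inclusion h).map f ≍ (inclusion h).map g) : f ≍ g := by
  subst ha hb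
  exact heq_of_eq (Subtype.ext (congr_arg Subtype.val (eq_of_heq hfg) :))

instance mono_nerveMap_inclusion {I J : Subcat C} (h : I ≤ J) : Mono (nerveMap (inclusion h)) := by
  rw [NatTrans.mono_iff_mono_app]
  intro n
  rw [mono_iff_injective]
  intro (x : Fin _ ⥤ I.Carrier) (y : Fin _ ⥤ I.Carrier) hxy
  replace hxy : x ⋙ inclusion h = y ⋙ inclusion h := hxy
  have hobj (i) : x.obj i = y.obj i :=
    Subtype.ext (congr_arg Subtype.val (Functor.congr_obj hxy i) :)
  exact Functor.hext hobj fun i j f ↦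
    heq_of_inclusion_map_heq h (hobj i) (hobj j) (Functor.hcongr_hom hxy f)

lemma nerve_weakEquivalence_iUnion (I : ℕ → Subcat C) (hI : ∀ n, I n ≤ I (n + 1))
    (h : ∀ n, IsNerveWeakEquivalence (inclusion (hI n))) :
    IsNerveWeakEquivalence (inclusion (le_iUnion I hI 0)) :=
  IsSSetWeakEquivalence.of_iUnion (X := fun n ↦ nerve (I n).Carrier) h
    (fun n ↦ nerveMap (inclusion (le_iUnion I hI n))) (fun _ ↦ rfl)
    (fun _ y ↦ exists_lift_iUnion I hI y)

end Subcat

/-! ### Cores and their components -/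

section Cores

variable {C : Type u} [Category.{v} C]

namespace IsCore

variable {I J : Subcat C}

lemma small_arrows (hI : IsCore.{w} I) : Small.{w} I.arrows := I.small_arrows_iff.2 hI.1

/-- A small subcategory containing a core with weak equivalence inclusion is a core. -/
lemma of_le (hI : IsCore.{w} I) (hJ : IsSmallCategory.{w} J.Carrier) (h : I ≤ J)
    (hw : IsNerveWeakEquivalence (Subcat.inclusion h)) : IsCore.{w} J := by
  refine ⟨hJ, fun L hL hJL ↦ ?_⟩
  obtain ⟨K, hK, hLK, hIK, hw'⟩ := hI.2 L hL (Subcat.le_trans h hJL)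
  exact ⟨K, hK, hLK, Subcat.le_trans hJL hLK, IsSSetWeakEquivalence.of_precomp hw hw'⟩

/-- A core is contained in a core containing any given small set of arrows. -/
lemma exists_le (hI : IsCore.{w} I) (S : Set (Arrow C)) [Small.{w} S] :
    ∃ K : Subcat C, IsCore.{w} K ∧ S ⊆ K.arrows ∧
      ∃ h : I ≤ K, IsNerveWeakEquivalence (Subcat.inclusion h) := by
  have := hI.small_arrows
  have hS := Subcat.subset_generate (I.arrows ∪ S)
  obtain ⟨K, hK, hLK, hIK, hw⟩ := hI.2 (Subcat.generate (I.arrows ∪ S))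
    (Subcat.isSmallCategory_generate _) (Subcat.le_iff.2 (Set.subset_union_left.trans hS))
  exact ⟨K, hI.of_le hK hIK hw,
    (Set.subset_union_right.trans hS).trans (Subcat.le_iff.1 hLK), hIK, hw⟩

lemma exists_ge (hI : IsCore.{w} I) (hJ : IsSmallCategory.{w} J.Carrier) :
    ∃ K : Subcat C, IsCore.{w} K ∧ J ≤ K ∧
      ∃ h : I ≤ K, IsNerveWeakEquivalence (Subcat.inclusion h) := by
  have := J.small_arrows_iff.2 hJ
  obtain ⟨K, hK, hJK, h⟩ := hI.exists_le J.arrows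
  exact ⟨K, hK, Subcat.le_iff.2 hJK, h⟩

/-- Inclusions between cores are weak equivalences. -/
lemma isNerveWeakEquivalence_inclusion (hI : IsCore.{w} I) (hJ : IsCore.{w} J) (h : I ≤ J) :
    IsNerveWeakEquivalence (Subcat.inclusion h) := by
  obtain ⟨K, hK, hJK, hIK, hwK⟩ := hI.exists_ge hJ.1
  obtain ⟨L, hL, hKL, hJL, hwL⟩ := hJ.exists_ge hK.1
  -- In `I ≤ J ≤ K ≤ L` the inclusions `I ≤ K` and `J ≤ L` are weak equivalences; two-out-of-six
  -- gives the middle one.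
  have hJK' : IsNerveWeakEquivalence (Subcat.inclusion hJK) :=
    IsSSetWeakEquivalence.of_comp_of_comp (f := nerveMap (Subcat.inclusion h))
      (h := nerveMap (Subcat.inclusion hKL)) hwK hwL
  exact IsSSetWeakEquivalence.of_postcomp hJK' hwK

/-- Any two cores are contained in a common core. -/
lemma exists_common (hI : IsCore.{w} I) (hJ : IsCore.{w} J) :
    ∃ K : Subcat C, IsCore.{w} K ∧ I ≤ K ∧ J ≤ K := by
  obtain ⟨K, hK, hJK, hIK, -⟩ := hI.exists_ge hJ.1
  exact ⟨K, hK, hIK, hJK⟩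

lemma weaklyEquivalent (hI : IsCore.{w} I) (hJ : IsCore.{w} J) :
    WeaklyEquivalent.{w} I.Carrier J.Carrier := by
  obtain ⟨K, hK, hIK, hJK⟩ := hI.exists_common hJ
  exact .trans _ (Cat.of K.Carrier) _
    (.rel _ _ ⟨hI.1, hK.1, _, hI.isNerveWeakEquivalence_inclusion hK hIK⟩)
    (.symm _ _ (.rel _ _ ⟨hJ.1, hK.1, _, hJ.isNerveWeakEquivalence_inclusion hK hJK⟩))

/-- An increasing union of a sequence of cores is a core. -/
lemma iUnion {I : ℕ → Subcat C} (hI : ∀ n, IsCore.{w} (I n)) (h : ∀ n, I n ≤ I (n + 1)) :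
    IsCore.{w} (Subcat.iUnion I h) :=
  (hI 0).of_le (Subcat.isSmallCategory_iUnion I h fun n ↦ (hI n).1) (Subcat.le_iUnion I h 0)
    (Subcat.nerve_weakEquivalence_iUnion I h fun n ↦
      (hI n).isNerveWeakEquivalence_inclusion (hI (n + 1)) (h n))

/-- Each of the finitely many arrows of the zigzag can be added to the core in turn. -/
lemma exists_zigzag (hI : IsCore.{w} I) (x : I.Carrier) {y : C} (h : Zigzag x.1 y) :
    ∃ (K : Subcat C) (_ : IsCore.{w} K) (hIK : I ≤ K) (hy : K.obj y),
      Zigzag ((Subcat.inclusion hIK).obj x) ⟨y, hy⟩ := by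
  induction h with
  | refl => exact ⟨I, hI, I.le_refl, x.2, .refl _⟩
  | @tail y z _ h ih =>
    obtain ⟨K, hK, hIK, hy, hxy⟩ := ih
    have key (a : Arrow C) : ∃ (L : Subcat C), IsCore.{w} L ∧ K ≤ L ∧ L.hom a.hom := by
      obtain ⟨L, hL, ha, hKL, -⟩ := hK.exists_le {a}
      exact ⟨L, hL, hKL, ha rfl⟩
    obtain ⟨⟨f⟩⟩ | ⟨⟨f⟩⟩ := h
    · obtain ⟨L, hL, hKL, hf⟩ := key (Arrow.mk f)
      refine ⟨L, hL, Subcat.le_trans hIK hKL, L.target_mem _ hf,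
        (zigzag_obj_of_zigzag (Subcat.inclusion hKL) hxy).trans (.of_hom ?_)⟩
      exact ⟨f, hf⟩
    · obtain ⟨L, hL, hKL, hf⟩ := key (Arrow.mk f)
      refine ⟨L, hL, Subcat.le_trans hIK hKL, L.source_mem _ hf,
        (zigzag_obj_of_zigzag (Subcat.inclusion hKL) hxy).trans (.of_inv ?_)⟩
      exact ⟨f, hf⟩

lemma bijective_mapConnectedComponents (hI : IsCore.{w} I) :
    Function.Bijective I.ι.mapConnectedComponents := by
  constructor
  · intro a b h
    induction a using Quotient.inductionOn with | _ x
    induction b using Quotient.inductionOn with | _ y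
    obtain ⟨K, hK, hIK, hy, hxy⟩ := hI.exists_zigzag x (Quotient.exact h : Zigzag x.1 y.1)
    exact ((hI.isNerveWeakEquivalence_inclusion hK hIK).bijective_mapConnectedComponents).1
      (Quotient.sound hxy)
  · intro c
    induction c using Quotient.inductionOn with | _ x
    obtain ⟨K, hK, hx, hIK, hw⟩ := hI.exists_le {Arrow.mk (𝟙 x)}
    obtain ⟨a, ha⟩ := hw.bijective_mapConnectedComponents.2
      (Quotient.mk _ ⟨x, (K.obj_iff x).2 (hx rfl)⟩)
    refine ⟨a, ?_⟩
    have := congr_arg K.ι.mapConnectedComponents ha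
    induction a using Quotient.inductionOn
    exact this

end IsCore

namespace IsEssentiallySmall

lemma small_connectedComponents (hC : IsEssentiallySmall.{w} C) :
    Small.{w} (CategoryTheory.ConnectedComponents C) := by
  obtain ⟨I, hI⟩ := hC
  have := hI.1.1
  exact small_of_surjective (f := fun x : I.Carrier ↦
    I.ι.mapConnectedComponents (CategoryTheory.ConnectedComponents.mk x))
    (hI.bijective_mapConnectedComponents.2.comp Quotient.mk_surjective)

lemma isSmallCategory_of_isDiscrete [IsDiscrete C] (hC : IsEssentiallySmall.{w} C) :
    IsSmallCategory.{w} C := by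
  have := hC.small_connectedComponents
  refine ⟨small_of_injective (f := CategoryTheory.ConnectedComponents.mk (J := C)) ?_,
    ⟨fun x y ↦ inferInstance⟩⟩
  intro x y h
  have hxy : Zigzag x y := Quotient.exact h
  induction hxy with
  | refl => rfl
  | tail h₁ h₂ ih =>
    refine (ih (Quotient.sound h₁)).trans ?_
    obtain ⟨⟨f⟩⟩ | ⟨⟨f⟩⟩ := h₂
    · exact IsDiscrete.eq_of_hom f
    · exact (IsDiscrete.eq_of_hom f).symm

end IsEssentiallySmall

end Cores

/-! ### Closure under functors and natural transformations -/

section Closure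

variable {C D : Type u} [Category.{v} C] [Category.{v} D]

/-- A pair of subcategories is closed under an assignment of sets of arrows to arrows if the
arrows of the first are assigned arrows of the second. -/
def Closed (φ : Arrow C → Set (Arrow D)) (I : Subcat C) (J : Subcat D) : Prop :=
  ∀ a ∈ I.arrows, φ a ⊆ J.arrows

/-- Each stage need only send its arrows to the next stage; exact closure appears in the limit. -/
lemma Closed.iUnion {φ : Arrow C → Set (Arrow D)} {I : ℕ → Subcat C} {J : ℕ → Subcat D}
    (hI : ∀ n, I n ≤ I (n + 1)) (hJ : ∀ n, J n ≤ J (n + 1))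
    (h : ∀ n, Closed φ (I n) (J (n + 1))) :
    Closed φ (Subcat.iUnion I hI) (Subcat.iUnion J hJ) := by
  intro a ⟨n, ha⟩
  exact (h n a ha).trans (Subcat.le_iff.1 (Subcat.le_iUnion J hJ _))

/-- The arrows assigned to the arrows of a subcategory. -/
def assigned (φ : Arrow C → Set (Arrow D)) (I : Subcat C) : Set (Arrow D) :=
  ⋃ a : I.arrows, φ a

instance small_assigned (φ : Arrow C → Set (Arrow D)) [∀ a, Small.{w} (φ a)] (I : Subcat C)
    [Small.{w} I.arrows] : Small.{w} (assigned φ I) := by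
  unfold assigned; infer_instance

lemma closed_iff {φ : Arrow C → Set (Arrow D)} {I : Subcat C} {J : Subcat D} :
    Closed φ I J ↔ assigned φ I ⊆ J.arrows := by
  simp [Closed, assigned]

/-- The assignment of arrows given by a functor. -/
def functorAssignment (F : C ⥤ D) (a : Arrow C) : Set (Arrow D) := {Arrow.mk (F.map a.hom)}

instance (F : C ⥤ D) (a : Arrow C) : Small.{w} (functorAssignment F a) := by
  unfold functorAssignment; infer_instance

lemma Closed.mapsTo {F : C ⥤ D} {I : Subcat C} {J : Subcat D}
    (h : Closed (functorAssignment F) I J) : Subcat.MapsTo F I J := by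
  have hom {x y : C} (f : x ⟶ y) (hf : I.hom f) : J.hom (F.map f) :=
    h (Arrow.mk f) hf (Set.mem_singleton _)
  exact ⟨fun x hx ↦ J.source_mem _ (hom (𝟙 x) (I.id_mem x hx)), hom⟩

/-- The natural transformation between restricted functors. -/
def restrictNatTrans {F G : C ⥤ D} (τ : F ⟶ G) {I : Subcat C} {J : Subcat D}
    (hF : Subcat.MapsTo F I J) (hG : Subcat.MapsTo G I J) (h : ∀ x, I.obj x → J.hom (τ.app x)) :
    Subcat.restrict F hF ⟶ Subcat.restrict G hG where
  app x := ⟨τ.app x.1, h x.1 x.2⟩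
  naturality _ _ f := Subtype.ext (τ.naturality f.1)

/-- Any zigzag of natural transformations restricts to the pairs of subcategories which are closed
under a suitable assignment of small sets of arrows. -/
lemma exists_assignment_of_zigzag {F G : C ⥤ D} (h : Zigzag F G) :
    ∃ φ : Arrow C → Set (Arrow D), (∀ a, Small.{w} (φ a)) ∧
      ∀ (I : Subcat C) (J : Subcat D), Closed φ I J →
        ∃ (hF : Subcat.MapsTo F I J) (hG : Subcat.MapsTo G I J),
          Zigzag (Subcat.restrict F hF) (Subcat.restrict G hG) := by
  induction h with
  | refl => exact ⟨functorAssignment F, inferInstance, fun I J h ↦ ⟨h.mapsTo, h.mapsTo, .refl _⟩⟩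
  | @tail G G' _ h ih =>
    obtain ⟨φ, hφ, ih⟩ := ih
    obtain ⟨⟨τ⟩⟩ | ⟨⟨τ⟩⟩ := h
    -- The component at the source suffices, since every object is the source of its identity.
    · refine ⟨fun a ↦ φ a ∪ (functorAssignment G' a ∪ {Arrow.mk (τ.app a.left)}),
        inferInstance, fun I J h ↦ ?_⟩
      obtain ⟨hF, hG, hFG⟩ := ih I J fun a ha ↦ Set.subset_union_left.trans (h a ha)
      refine ⟨hF, Closed.mapsTo fun a ha b hb ↦ h a ha (.inr (.inl hb)), hFG.trans (.of_hom ?_)⟩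
      exact restrictNatTrans τ _ _ fun x hx ↦
        h (Arrow.mk (𝟙 x)) (I.id_mem x hx) (.inr (.inr rfl))
    · refine ⟨fun a ↦ φ a ∪ (functorAssignment G' a ∪ {Arrow.mk (τ.app a.left)}),
        inferInstance, fun I J h ↦ ?_⟩
      obtain ⟨hF, hG, hFG⟩ := ih I J fun a ha ↦ Set.subset_union_left.trans (h a ha)
      refine ⟨hF, Closed.mapsTo fun a ha b hb ↦ h a ha (.inr (.inl hb)), hFG.trans (.of_inv ?_)⟩
      exact restrictNatTrans τ _ _ fun x hx ↦
        h (Arrow.mk (𝟙 x)) (I.id_mem x hx) (.inr (.inr rfl))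

end Closure

/-! ### Homotopy retracts and homotopy equivalences -/

section HomotopyRetract

variable {A B : Type u} [Category.{v} A] [Category.{v} B]

/-- A core of `A` and a small subcategory of `B` can be enlarged to a core and a small subcategory
closed under given assignments of small sets of arrows. -/
lemma IsCore.exists_closed {I₀ : Subcat A} {J₀ : Subcat B} (hI₀ : IsCore.{w} I₀)
    (hJ₀ : IsSmallCategory.{w} J₀.Carrier)
    (φAA : Arrow A → Set (Arrow A)) (φAB : Arrow A → Set (Arrow B))
    (φBA : Arrow B → Set (Arrow A)) (φBB : Arrow B → Set (Arrow B))
    [∀ a, Small.{w} (φAA a)] [∀ a, Small.{w} (φAB a)] [∀ b, Small.{w} (φBA b)]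
    [∀ b, Small.{w} (φBB b)] :
    ∃ (I : Subcat A) (J : Subcat B), IsCore.{w} I ∧ IsSmallCategory.{w} J.Carrier ∧
      I₀ ≤ I ∧ J₀ ≤ J ∧ Closed φAA I I ∧ Closed φAB I J ∧ Closed φBA J I ∧ Closed φBB J J := by
  let Stage := {p : Subcat A × Subcat B // IsCore.{w} p.1 ∧ IsSmallCategory.{w} p.2.Carrier}
  have step (p : Stage) : ∃ q : Stage, p.1.1 ≤ q.1.1 ∧ p.1.2 ≤ q.1.2 ∧
      Closed φAA p.1.1 q.1.1 ∧ Closed φAB p.1.1 q.1.2 ∧ Closed φBA p.1.2 q.1.1 ∧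
        Closed φBB p.1.2 q.1.2 := by
    obtain ⟨⟨I, J⟩, hI, hJ⟩ := p
    have := hI.small_arrows
    have := J.small_arrows_iff.2 hJ
    -- In `A` the enlargement uses the core property; in `B`, where no core is given, it is plain
    -- generation.
    obtain ⟨K, hK, hS, hIK, -⟩ := hI.exists_le (assigned φAA I ∪ assigned φBA J)
    have hT := Subcat.subset_generate (J.arrows ∪ (assigned φAB I ∪ assigned φBB J))
    simp only [Set.union_subset_iff] at hS hT
    exact ⟨⟨⟨K, _⟩, hK, Subcat.isSmallCategory_generate _⟩, hIK, Subcat.le_iff.2 hT.1,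
      closed_iff.2 hS.1, closed_iff.2 hT.2.1, closed_iff.2 hS.2, closed_iff.2 hT.2.2⟩
  choose next h₁ h₂ hAA hAB hBA hBB using step
  let p (n : ℕ) : Stage := Nat.rec ⟨(I₀, J₀), hI₀, hJ₀⟩ (fun _ ↦ next) n
  have hI (n : ℕ) : (p n).1.1 ≤ (p (n + 1)).1.1 := h₁ (p n)
  have hJ (n : ℕ) : (p n).1.2 ≤ (p (n + 1)).1.2 := h₂ (p n)
  exact ⟨Subcat.iUnion _ hI, Subcat.iUnion _ hJ, .iUnion (fun n ↦ (p n).2.1) hI,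
    Subcat.isSmallCategory_iUnion _ hJ fun n ↦ (p n).2.2, Subcat.le_iUnion _ hI 0,
    Subcat.le_iUnion _ hJ 0, .iUnion hI hI fun n ↦ hAA (p n), .iUnion hI hJ fun n ↦ hAB (p n),
    .iUnion hJ hI fun n ↦ hBA (p n), .iUnion hJ hJ fun n ↦ hBB (p n)⟩

variable {f : B ⥤ A} {r : A ⥤ B}

/-- A small subcategory of `B` which is a homotopy retract of a core of `A` is a core, if the
homotopy is controlled by an assignment of arrows. -/
lemma IsCore.of_homotopy_retract {φ : Arrow B → Set (Arrow B)} [∀ b, Small.{w} (φ b)]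
    (hφ : ∀ I J : Subcat B, Closed φ I J →
      ∃ (h : Subcat.MapsTo (f ⋙ r) I J) (h' : Subcat.MapsTo (𝟭 B) I J),
        Zigzag (Subcat.restrict (f ⋙ r) h) (Subcat.restrict (𝟭 B) h'))
    {I : Subcat A} {J : Subcat B} (hI : IsCore.{w} I) (hJ : IsSmallCategory.{w} J.Carrier)
    (hr : Closed (functorAssignment r) I J) (hf : Closed (functorAssignment f) J I)
    (hJJ : Closed φ J J) : IsCore.{w} J := by
  refine ⟨hJ, fun L hL hJL ↦ ?_⟩
  obtain ⟨I', J', hI', hJ', hII', hLJ', -, hr', hf', hJJ'⟩ := hI.exists_closed hL (fun _ ↦ ∅)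
    (functorAssignment r) (functorAssignment f) φ
  refine ⟨J', hJ', hLJ', Subcat.le_trans hJL hLJ', ?_⟩
  obtain ⟨_, _, h⟩ := hφ J J hJJ
  obtain ⟨_, _, h'⟩ := hφ J' J' hJJ'
  -- The inclusion `J ≤ J'` is a homotopy retract of `I ≤ I'`; both squares commute strictly.
  exact IsSSetWeakEquivalence.of_homotopy_retract
    (hI.isNerveWeakEquivalence_inclusion hI' hII')
    (nerveMap (Subcat.restrict f hf.mapsTo)) (nerveMap (Subcat.restrict f hf'.mapsTo))
    (nerveMap (Subcat.restrict r hr.mapsTo)) (nerveMap (Subcat.restrict r hr'.mapsTo))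
    rfl rfl (sameHomotopyClass_of_zigzag h) (sameHomotopyClass_of_zigzag h')

/-- A homotopy retract of an essentially small category is essentially small, and there are
compatible cores. -/
lemma exists_cores_of_homotopy_retract (hA : IsEssentiallySmall.{w} A)
    (h : FunctorHomotopic (f ⋙ r) (𝟭 B)) :
    ∃ (J : Subcat A) (I : Subcat B), IsCore.{w} J ∧ IsCore.{w} I ∧
      Subcat.MapsTo f I J ∧ Subcat.MapsTo r J I := by
  obtain ⟨I₀, hI₀⟩ := hA
  obtain ⟨φ, _, hφ⟩ := exists_assignment_of_zigzag.{w} h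
  obtain ⟨I, J, hI, hJ, -, -, -, hr, hf, hJJ⟩ := hI₀.exists_closed
    (Subcat.isSmallCategory_generate.{w} (C := B) ∅) (fun _ ↦ ∅)
    (functorAssignment r) (functorAssignment f) φ
  exact ⟨I, J, hI, .of_homotopy_retract hφ hI hJ hr hf hJJ, hf.mapsTo, hr.mapsTo⟩

lemma isWeakEquivalence_of_isHomotopyEquivalence (hA : IsEssentiallySmall.{w} A)
    (h : IsHomotopyEquivalence f) : IsWeakEquivalence.{w} f := by
  obtain ⟨I₀, hI₀⟩ := hA
  obtain ⟨r, h₁, h₂⟩ := h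
  obtain ⟨φ, _, hφ⟩ := exists_assignment_of_zigzag.{w} h₂
  obtain ⟨ψ, _, hψ⟩ := exists_assignment_of_zigzag.{w} h₁
  -- Closing `I` under `ψ` as well keeps the homotopy on the `A` side inside `I`.
  obtain ⟨I, J, hI, hJ, -, -, hII, hr, hf, hJJ⟩ := hI₀.exists_closed
    (Subcat.isSmallCategory_generate.{w} (C := B) ∅) ψ
    (functorAssignment r) (functorAssignment f) φ
  obtain ⟨_, _, hJ'⟩ := hφ J J hJJ
  obtain ⟨_, _, hI'⟩ := hψ I I hII
  exact ⟨J, I, .of_homotopy_retract hφ hI hJ hr hf hJJ, hI, hf.mapsTo,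
    IsSSetWeakEquivalence.of_homotopy_inverse (g := nerveMap (Subcat.restrict r hr.mapsTo))
      (sameHomotopyClass_of_zigzag hJ') (sameHomotopyClass_of_zigzag hI')⟩

end HomotopyRetract

end CoreHomotopy

theorem mainTheorem9 :
    -- any two cores of a category are weakly equivalent
    (∀ (C : Type u) [Category.{v} C] (I J : CoreHomotopy.Subcat C),
      CoreHomotopy.IsCore.{w} I → CoreHomotopy.IsCore.{w} J →
        CoreHomotopy.WeaklyEquivalent.{w} I.Carrier J.Carrier) ∧
    -- a discrete essentially small category is small
    (∀ (C : Type u) [Category.{v} C], IsDiscrete C →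
      CoreHomotopy.IsEssentiallySmall.{w} C → CoreHomotopy.IsSmallCategory.{w} C) ∧
    -- the components of an essentially small category form a set
    (∀ (C : Type u) [Category.{v} C], CoreHomotopy.IsEssentiallySmall.{w} C →
      Small.{w} (ConnectedComponents C)) ∧
    -- the inclusion of a core is a bijection on components
    (∀ (C : Type u) [Category.{v} C] (I : CoreHomotopy.Subcat C), CoreHomotopy.IsCore.{w} I →
      Function.Bijective I.ι.mapConnectedComponents) ∧
    -- homotopy retracts of essentially small categories, with compatible cores
    (∀ (B A : Type u) [Category.{v} B] [Category.{v} A] (f : B ⥤ A) (r : A ⥤ B),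
      CoreHomotopy.IsEssentiallySmall.{w} A → CoreHomotopy.FunctorHomotopic (f ⋙ r) (𝟭 B) →
        CoreHomotopy.IsEssentiallySmall.{w} B ∧
        ∃ (J : CoreHomotopy.Subcat A) (I : CoreHomotopy.Subcat B),
          CoreHomotopy.IsCore.{w} J ∧ CoreHomotopy.IsCore.{w} I ∧
          CoreHomotopy.Subcat.MapsTo f I J ∧ CoreHomotopy.Subcat.MapsTo r J I) ∧
    -- essential smallness is invariant under homotopy equivalence
    (∀ (B A : Type u) [Category.{v} B] [Category.{v} A] (f : B ⥤ A),
      CoreHomotopy.IsHomotopyEquivalence f →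
        (CoreHomotopy.IsEssentiallySmall.{w} A ↔ CoreHomotopy.IsEssentiallySmall.{w} B)) ∧
    -- homotopy equivalences of essentially small categories are weak equivalences
    (∀ (B A : Type u) [Category.{v} B] [Category.{v} A] (f : B ⥤ A),
      CoreHomotopy.IsEssentiallySmall.{w} B → CoreHomotopy.IsEssentiallySmall.{w} A →
      CoreHomotopy.IsHomotopyEquivalence f → CoreHomotopy.IsWeakEquivalence.{w} f) := by
  refine ⟨fun C _ I J hI hJ ↦ hI.weaklyEquivalent hJ,
    fun C _ _ hC ↦ hC.isSmallCategory_of_isDiscrete, fun C _ hC ↦ hC.small_connectedComponents,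
    fun C _ I hI ↦ hI.bijective_mapConnectedComponents, fun B A _ _ f r hA h ↦ ?_,
    fun B A _ _ f h ↦ ?_, fun B A _ _ f _ hA h ↦
      CoreHomotopy.isWeakEquivalence_of_isHomotopyEquivalence hA h⟩
  · obtain ⟨J, I, hJ, hI, h'⟩ := CoreHomotopy.exists_cores_of_homotopy_retract hA h
    exact ⟨⟨I, hI⟩, J, I, hJ, hI, h'⟩
  -- Each of the two categories is a homotopy retract of the other.
  · obtain ⟨g, h₁, h₂⟩ := h
    constructor
    · intro hA
      obtain ⟨-, I, -, hI, -⟩ := CoreHomotopy.exists_cores_of_homotopy_retract hA h₂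
      exact ⟨I, hI⟩
    · intro hB
      obtain ⟨-, I, -, hI, -⟩ := CoreHomotopy.exists_cores_of_homotopy_retract hB h₁
      exact ⟨I, hI⟩
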